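/- Let $G$ be a finite connected simple digraph (no loops, at most one edge joining any two vertices) with $n_V\ge 1$ vertices and $n_E$ edges. Let $E_D$ be the set of the $2n_E$ directed edges consisting of the edges $e$ of $G$ and their inverses $e^{-1}$. A cycle of length $l\ge 1$ is a sequence $C=a_1\cdots a_l$ in $E_D$ in which the target of $a_i$ is the source of $a_{i+1}$ for every $i$ modulo $l$; write $|C|=l$, and let $b(C)$ be the number of $i$ modulo $l$ with $a_{i+1}=a_i^{-1}$. Cycles differing by a cyclic rotation are identified, and $C$ is primitive if it is not a power $P^r$ of a cycle $P$ with $r\ge 2$. For each $u\in\mathbb C$ the Bartholdi zeta function $q\mapsto\zeta_G(q,u)$ is the meromorphic function on $\mathbb C$ that for all sufficiently small $|q|$ equals the absolutely convergent Euler product $$\zeta_G(q,u)=\prod_{[C]\ \text{primitive}}\frac{1}{1-q^{|C|}u^{b(C)}} .$$ This meromorphic function exists for every $u\neq 1$. Put $u_*=1-\frac{n_E}{n_V}$. Let $L$ be the $n_E\times n_V$ incidence matrix ($L_{ev}=1$ if $v$ is the target of $e$, $-1$ if $v$ is the source of $e$, and $0$ otherwise), $L^+$ its Moore–Penrose inverse,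 and $\vec d$ the vector of the vertex degrees (numbers of neighbours in the underlying undirected graph). "Connected" and "tree" refer to the underlying undirected graph. Theorem. Let $u\in\mathbb C$ with $u\ne 1$. 1. If $G$ is not a tree and $u\neq u_*$, then $q=(1-u)^{-1}$ is a pole of $\zeta_G(q,u)$ of order exactly $n_E-n_V+1$. If $G$ is not a tree, then $q=(1-u)^{-1}$ is a pole of order at least $n_E-n_V+2$ if and only if $u=u_*$. 2. If $G$ is a tree, then $q=(1-u)^{-1}$ is a pole of $\zeta_G(q,u)$ if and only if $u=u_*$. 3. Whether or not $G$ is a tree, if $|(L^+)^T\vec d\,|^2\neq n_E$ (Euclidean norm) and $u=u_*$, then $q=(1-u)^{-1}$ is a pole of $\zeta_G(q,u)$ of order exactly $n_E-n_V+2$. -/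

import Mathlib

namespace Bartholdi

section Cycles

variable {V : Type*} (G : SimpleGraph V)

/-- A choice of direction for every edge of the simple graph `G`. A simple digraph (no loops, at
most one edge joining two vertices) is the same thing as a simple graph with such a choice. -/
structure EdgeOrientation where
  /-- the source `s(e)` -/
  src : G.edgeSet → V
  /-- the target `t(e)` -/
  tgt : G.edgeSet → V
  edge_eq : ∀ e : G.edgeSet, s(src e, tgt e) = (e : Sym2 V)

variable {G}

/- The darts `G.Dart` are the `2 n_E` directed edges `e`, `e⁻¹` (the inverse is `Dart.symm`), and
`G.DartAdj a b` says that the target of `a` is the source of `b`. Mathlib's `Cycle G.Dart` is the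
type of lists of darts up to cyclic rotation. -/

/-- `C` is the rotation class of a cycle `a₁ a₂ ⋯ aₗ` of `G`, `l ≥ 1`: the target of every `aᵢ` is
the source of `aᵢ₊₁`, and the target of `aₗ` is the source of `a₁`. -/
def IsCycle (C : Cycle G.Dart) : Prop :=
  C ≠ Cycle.nil ∧ C.Chain G.DartAdj

/-- `C` is not (the rotation class of) a power `Pʳ` with `r ≥ 2` of a cycle `P`. -/
def IsPrimitive (C : Cycle G.Dart) : Prop :=
  ∀ (P : List G.Dart) (r : ℕ), IsCycle (P : Cycle G.Dart) → 2 ≤ r →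
    C ≠ ((List.replicate r P).flatten : Cycle G.Dart)

/-- The number of bumps of `a₁ ⋯ aₗ`: the number of `i` such that `aᵢ₊₁ = aᵢ⁻¹`, with `i` taken
modulo `l` (so that backtrackings and the tail are both counted). -/
def listBumps [DecidableEq V] (l : List G.Dart) : ℕ :=
  (List.zip l (l.rotate 1)).countP fun p => p.2 = p.1.symm

theorem listBumps_congr [DecidableEq V] {l l' : List G.Dart} (h : l ~r l') :
    listBumps l = listBumps l' := by
  obtain ⟨n, rfl⟩ := h
  have h1 : List.zip (l.rotate n) ((l.rotate n).rotate 1) =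
      (List.zip l (l.rotate 1)).rotate n := by
    rw [List.rotate_rotate, Nat.add_comm n 1, ← List.rotate_rotate]
    exact (List.zipWith_rotate_distrib Prod.mk l (l.rotate 1) n (by simp)).symm
  unfold listBumps
  rw [h1]
  exact ((List.rotate_perm _ n).countP_eq _).symm

/-- The number of bumps `b(C)` of a rotation class. -/
def bumps [DecidableEq V] (C : Cycle G.Dart) : ℕ :=
  Quotient.liftOn' C listBumps fun _ _ h => listBumps_congr h

variable (G) in
/-- The rotation classes of the primitive cycles of `G`. -/
def PrimitiveCycle : Type _ :=
  {C : Cycle G.Dart // IsCycle C ∧ IsPrimitive C}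

variable (G) in
/-- `ζ` is the Bartholdi zeta function `q ↦ ζ_G(q, u)` of `G` with bump parameter `u`: it is
meromorphic on `ℂ` and for all small `q` it is the value of the (unconditionally convergent) Euler
product `∏_C (1 - q ^ |C| u ^ b(C))⁻¹` over the rotation classes of primitive cycles. -/
def IsBartholdiZeta [DecidableEq V] (u : ℂ) (ζ : ℂ → ℂ) : Prop :=
  Meromorphic ζ ∧
    ∀ᶠ q in nhds (0 : ℂ),
      HasProd (fun C : PrimitiveCycle G => (1 - q ^ C.1.length * u ^ bumps C.1)⁻¹) (ζ q)

end Cycles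

section Poles

/-- `x` is a pole of `f`. -/
def IsPole (f : ℂ → ℂ) (x : ℂ) : Prop :=
  MeromorphicAt f x ∧ meromorphicOrderAt f x < 0

/-- `x` is a pole of `f` of order exactly `k` (in particular `k ≥ 1`). -/
def HasPoleOfOrder (f : ℂ → ℂ) (x : ℂ) (k : ℤ) : Prop :=
  0 < k ∧ MeromorphicAt f x ∧ meromorphicOrderAt f x = ((-k : ℤ) : WithTop ℤ)

end Poles

section MoorePenrose

variable {m n : Type*} [Fintype m] [Fintype n]

/-- `N` is the Moore-Penrose inverse of the real matrix `M`: the four Penrose equations. -/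
structure IsMoorePenroseInverse (M : Matrix m n ℝ) (N : Matrix n m ℝ) : Prop where
  mul_mul_self : M * N * M = M
  self_mul_mul : N * M * N = N
  left_symm : (N * M).transpose = N * M
  right_symm : (M * N).transpose = M * N

theorem IsMoorePenroseInverse.unique {M : Matrix m n ℝ} {N N' : Matrix n m ℝ}
    (h : IsMoorePenroseInverse M N) (h' : IsMoorePenroseInverse M N') : N = N' := by
  have e1 : M * N = M * N' := by
    have h2 : (M * N') * (M * N) = M * N := by
      rw [← Matrix.mul_assoc, h'.mul_mul_self]
    have h3 : (M * N) * (M * N') = M * N' := by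
      rw [← Matrix.mul_assoc, h.mul_mul_self]
    calc M * N = ((M * N') * (M * N)).transpose := by rw [h2, h.right_symm]
      _ = (M * N) * (M * N') := by rw [Matrix.transpose_mul, h.right_symm, h'.right_symm]
      _ = M * N' := h3
  have e2 : N * M = N' * M := by
    have h2 : (N * M) * (N' * M) = N * M := by
      rw [Matrix.mul_assoc, ← Matrix.mul_assoc M, h'.mul_mul_self]
    have h3 : (N' * M) * (N * M) = N' * M := by
      rw [Matrix.mul_assoc, ← Matrix.mul_assoc M, h.mul_mul_self]
    calc N * M = ((N * M) * (N' * M)).transpose := by rw [h2, h.left_symm]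
      _ = (N' * M) * (N * M) := by rw [Matrix.transpose_mul, h.left_symm, h'.left_symm]
      _ = N' * M := h3
  calc N = N * M * N := h.self_mul_mul.symm
    _ = N' * M * N' := by rw [e2, Matrix.mul_assoc, e1, ← Matrix.mul_assoc]
    _ = N' := h'.self_mul_mul

theorem exists_isMoorePenroseInverse (M : Matrix m n ℝ) :
    ∃ N : Matrix n m ℝ, IsMoorePenroseInverse M N := by
  classical
  have hH : (M.transpose * M).IsHermitian := by
    have := Matrix.isHermitian_conjTranspose_mul_self M
    rwa [Matrix.conjTranspose_eq_transpose_of_trivial] at this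
  set H := M.transpose * M with hHdef
  set U : Matrix n n ℝ := (hH.eigenvectorUnitary : Matrix n n ℝ) with hU
  have hUU : U.transpose * U = 1 := by
    have h := Unitary.coe_star_mul_self hH.eigenvectorUnitary
    rwa [Matrix.star_eq_conjTranspose,
      Matrix.conjTranspose_eq_transpose_of_trivial] at h
  set d := hH.eigenvalues with hd
  have hspec : H = U * Matrix.diagonal d * U.transpose := by
    have h := hH.spectral_theorem
    rw [Unitary.conjStarAlgAut_apply] at h
    simpa [Matrix.star_eq_conjTranspose, Function.comp_def] using h
  set K := U * Matrix.diagonal (fun i => (d i)⁻¹) * U.transpose with hK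
  have key : ∀ a b : n → ℝ, (U * Matrix.diagonal a * U.transpose) *
      (U * Matrix.diagonal b * U.transpose) =
        U * Matrix.diagonal (fun i => a i * b i) * U.transpose := by
    intro a b
    calc _ = U * Matrix.diagonal a * (U.transpose * U) * Matrix.diagonal b * U.transpose := by
          simp only [Matrix.mul_assoc]
      _ = _ := by rw [hUU, Matrix.mul_one, Matrix.mul_assoc U, Matrix.diagonal_mul_diagonal]
  have symm : ∀ a : n → ℝ, (U * Matrix.diagonal a * U.transpose).transpose =
      U * Matrix.diagonal a * U.transpose := by
    intro a
    simp [Matrix.transpose_mul, Matrix.mul_assoc]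
  have hKsymm : K.transpose = K := symm _
  have hKH : K * H = U * Matrix.diagonal (fun i => (d i)⁻¹ * d i) * U.transpose := by
    rw [hspec, hK, key]
  have hKHsymm : (K * H).transpose = K * H := by rw [hKH, symm]
  have hHKH : H * (K * H) = H := by
    rw [hKH, hspec, key]
    congr 3
    funext i
    by_cases h : d i = 0 <;> simp [h]
  have hKHK : K * H * K = K := by
    rw [hKH, hK, key]
    congr 3
    funext i
    by_cases h : d i = 0 <;> simp [h]
  have hM : M * (K * H) = M := by
    have h0 : (M - M * (K * H)).transpose * (M - M * (K * H)) = 0 := by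
      have hz : M.transpose * (M - M * (K * H)) = 0 := by
        rw [Matrix.mul_sub, ← Matrix.mul_assoc, ← hHdef, hHKH, sub_self]
      rw [Matrix.transpose_sub, Matrix.transpose_mul, Matrix.sub_mul,
        Matrix.mul_assoc (K * H).transpose, hz, Matrix.mul_zero, sub_zero]
    rw [← Matrix.conjTranspose_eq_transpose_of_trivial,
      Matrix.conjTranspose_mul_self_eq_zero] at h0
    exact (sub_eq_zero.mp h0).symm
  refine ⟨K * M.transpose, ?_, ?_, ?_, ?_⟩
  · rw [Matrix.mul_assoc, Matrix.mul_assoc K, ← hHdef, hM]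
  · rw [Matrix.mul_assoc K, ← hHdef, ← Matrix.mul_assoc, hKHK]
  · rw [Matrix.mul_assoc K, ← hHdef, hKHsymm]
  · simp [Matrix.transpose_mul, hKsymm, Matrix.mul_assoc]

/-- The Moore-Penrose inverse `M⁺`, the unique solution of the four Penrose equations. -/
noncomputable def moorePenroseInverse (M : Matrix m n ℝ) : Matrix n m ℝ :=
  Classical.choose (exists_isMoorePenroseInverse M)

theorem isMoorePenroseInverse_moorePenroseInverse (M : Matrix m n ℝ) :
    IsMoorePenroseInverse M (moorePenroseInverse M) :=
  Classical.choose_spec (exists_isMoorePenroseInverse M)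

end MoorePenrose

section Invariants

variable {V : Type*} [Fintype V] [DecidableEq V] (G : SimpleGraph V) [DecidableRel G.Adj]

/-- The number of vertices. -/
def nV (V : Type*) [Fintype V] : ℕ := Fintype.card V

/-- The number of edges. -/
def nE : ℕ := G.edgeFinset.card

/-- The critical bump parameter `u_* = 1 - n_E / n_V`. -/
noncomputable def uStar : ℂ := 1 - (nE G : ℂ) / (nV V : ℂ)

/-- The degree vector. -/
def degreeVector : V → ℝ := fun v => (G.degree v : ℝ)

variable {G} in
/-- The incidence matrix: `L e v` is `1` if `v = t(e)`, `-1` if `v = s(e)` and `0` otherwise. -/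
def incidence (o : EdgeOrientation G) : Matrix G.edgeSet V ℝ :=
  fun e v => if v = o.tgt e then 1 else if v = o.src e then -1 else 0

variable {G} in
/-- The vector `(L⁺)ᵀ d`, with the Euclidean norm. -/
noncomputable def pinvDegree (o : EdgeOrientation G) : EuclideanSpace ℝ G.edgeSet :=
  WithLp.toLp 2 ((moorePenroseInverse (incidence o)).transpose.mulVec (degreeVector G))

end Invariants

end Bartholdi

/-! Two determinant formulas turn the theorem into a perturbation problem for the graph Laplacian.

Euler product. Let `W` be the dart matrix with entry `u` at bumps and 1 at other admissible steps.
Every nonempty list is a unique power of a list with no rotational symmetry, and the class of such a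
list has as many members as its length. Summing `q ^ |l| W(l) / |l|` over all lists therefore gives
both the logarithm of the Euler product and `∑ tr(W ^ n) q ^ n / n`, so the zeta function is `det (1
- q W)⁻¹` (`isBartholdiZeta_det_inv`).

Bartholdi's formula. Write `w = 1 - u` and `x = q w`. Since `W` is a product factoring through the
vertices minus `w` times dart inversion, `det (1 - q W)` equals `(1 - x²) ^ (n_E - n_V)` times `det
(w (1 - x²) - x A + x² D)`, up to a power of `w`. At `x = 1` the first factor has order `n_E - n_V`;
the order `k` of the second remains to be found.

Perturbation. With `x = 1 + X` the matrix is a polynomial pencil `M` with `M(0) = D - A`, whose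
kernel is the constants. If `M v = X ^ k y` and `v(0) = 1`, Cramer's rule gives `X ^ k ∣ det M`,
with a quotient nonzero at 0 exactly if `∑ y(0) ≠ 0`. For `v = 1` this sum is `2 (n_E - n_V w)`, so
`k ≥ 2` iff `u = u_*`. In that case `v = 1 + X c` with `c = -L⁺ (L⁺)ᵀ d` reaches second order, with
sum `n_E - |(L⁺)ᵀ d|²`. -/

namespace Bartholdi

/-! ### Combinatorics on words: powers, rotations and primitive roots -/

section ListPowers

variable {α : Type*}

/-- The list `P ++ P ++ ⋯ ++ P` with `r` copies of `P`. -/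
def listPow (P : List α) (r : ℕ) : List α := (List.replicate r P).flatten

@[simp] theorem listPow_zero (P : List α) : listPow P 0 = [] := rfl

theorem listPow_succ (P : List α) (r : ℕ) : listPow P (r + 1) = P ++ listPow P r := by
  simp [listPow, List.replicate_succ]

@[simp] theorem length_listPow (P : List α) (r : ℕ) :
    (listPow P r).length = r * P.length := by
  simp [listPow]

theorem take_listPow_succ (P : List α) (r : ℕ) : (listPow P (r + 1)).take P.length = P := by
  rw [listPow_succ]; simp

theorem listPow_succ_injective (r : ℕ) :
    Function.Injective fun P : List α => listPow P (r + 1) := by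
  intro P Q h
  have h : listPow P (r + 1) = listPow Q (r + 1) := h
  have hl : P.length = Q.length := by
    have := congrArg List.length h
    simpa using this
  rw [← take_listPow_succ P r, ← take_listPow_succ Q r, h, hl]

/-- Commutation makes `x` a prefix of `y`. Removing it preserves commutation and lowers `k` by one.
-/
theorem eq_listPow_of_append_comm (x : List α) :
    ∀ (k : ℕ) (y : List α), y ++ x = x ++ y → y.length = k * x.length → y = listPow x k
  | 0, y, _, hl => by
      rw [Nat.zero_mul, List.length_eq_zero_iff] at hl
      simp [hl]
  | k + 1, y, h, hl => by
      have hp : x <+: y := by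
        apply List.prefix_of_prefix_length_le (l₃ := x ++ y) (List.prefix_append x y)
        · rw [← h]; exact List.prefix_append y x
        · rw [hl]; nlinarith
      obtain ⟨z, rfl⟩ := hp
      rw [listPow_succ, ← eq_listPow_of_append_comm x k z]
      · simpa [List.append_assoc] using h
      · simp only [List.length_append] at hl
        nlinarith

theorem eq_listPow_take_of_rotate_eq {l : List α} {p k : ℕ} (h : l.rotate p = l)
    (hl : l.length = (k + 1) * p) : l = listPow (l.take p) (k + 1) := by
  have hp : p ≤ l.length := by rw [hl]; nlinarith
  have e : l.take p ++ l.drop p = l := List.take_append_drop p l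
  have ht : (l.take p).length = p := by simp [hp]
  rw [List.rotate_eq_drop_append_take hp] at h
  conv_lhs => rw [← e]
  rw [listPow_succ, ← eq_listPow_of_append_comm (l.take p) k (l.drop p) (h.trans e.symm)]
  rw [ht, List.length_drop, hl, Nat.succ_mul, Nat.add_sub_cancel]

theorem rotate_one_listPow (P : List α) (r : ℕ) :
    (listPow P r).rotate 1 = listPow (P.rotate 1) r := by
  cases P with
  | nil => simp [listPow]
  | cons a t =>
    have key : ∀ s : ℕ, a :: listPow (t ++ [a]) s = listPow (a :: t) s ++ [a] := by
      intro s
      induction s with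
      | zero => simp
      | succ s ih => rw [listPow_succ, listPow_succ, List.append_assoc (a :: t), ← ih]; simp
    cases r with
    | zero => simp
    | succ r =>
      rw [listPow_succ, listPow_succ]
      simp only [List.cons_append, List.rotate_cons_succ, List.rotate_zero, List.append_assoc]
      rw [← key r]
      simp

theorem rotate_listPow (P : List α) (r n : ℕ) :
    (listPow P r).rotate n = listPow (P.rotate n) r := by
  induction n with
  | zero => simp
  | succ n ih => rw [← List.rotate_rotate, ih, rotate_one_listPow, List.rotate_rotate]

/-- The rotation of lists by one step. -/
def rot (l : List α) : List α := l.rotate 1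

theorem rot_iterate (n : ℕ) (l : List α) : rot^[n] l = l.rotate n := by
  induction n with
  | zero => simp
  | succ n ih => rw [Function.iterate_succ_apply', ih, rot, List.rotate_rotate]

theorem isPeriodicPt_rot_iff {n : ℕ} {l : List α} :
    Function.IsPeriodicPt rot n l ↔ l.rotate n = l := by
  rw [Function.IsPeriodicPt, Function.IsFixedPt, rot_iterate]

/-- The least period of `l` under rotation. -/
noncomputable def rotPeriod (l : List α) : ℕ := Function.minimalPeriod rot l

theorem rotate_eq_iff_rotPeriod_dvd {n : ℕ} {l : List α} :
    l.rotate n = l ↔ rotPeriod l ∣ n := by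
  rw [← isPeriodicPt_rot_iff, rotPeriod, Function.isPeriodicPt_iff_minimalPeriod_dvd]

theorem rotPeriod_dvd_length (l : List α) : rotPeriod l ∣ l.length :=
  rotate_eq_iff_rotPeriod_dvd.1 l.rotate_length

/-- Taking a positive power is injective and commutes with rotation, so `P` and its power are fixed
by the same rotations. -/
theorem rotPeriod_listPow_succ (P : List α) (r : ℕ) :
    rotPeriod (listPow P (r + 1)) = rotPeriod P := by
  apply Function.minimalPeriod_eq_minimalPeriod_iff.2
  intro n
  rw [isPeriodicPt_rot_iff, isPeriodicPt_rot_iff, rotate_listPow]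
  exact (listPow_succ_injective r).eq_iff

theorem rotPeriod_rotate (l : List α) (n : ℕ) : rotPeriod (l.rotate n) = rotPeriod l := by
  apply Function.minimalPeriod_eq_minimalPeriod_iff.2
  intro k
  rw [isPeriodicPt_rot_iff, isPeriodicPt_rot_iff, List.rotate_rotate, Nat.add_comm,
    ← List.rotate_rotate, List.rotate_eq_rotate]

/-- A nonempty list all of whose rotations are different. -/
def IsAperiodic (l : List α) : Prop := l ≠ [] ∧ rotPeriod l = l.length

theorem IsAperiodic.length_pos {l : List α} (h : IsAperiodic l) : 0 < l.length :=
  List.length_pos_iff.2 h.1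

/-- The root consists of the first `rotPeriod l` letters. The exponent is `r + 1`, which keeps it
positive. -/
theorem exists_aperiodic_root {l : List α} (hl : l ≠ []) :
    ∃ (P : List α) (r : ℕ), IsAperiodic P ∧ listPow P (r + 1) = l := by
  have hpos : 0 < l.length := List.length_pos_iff.2 hl
  obtain ⟨k, hk⟩ := rotPeriod_dvd_length l
  have hk0 : k ≠ 0 := by rintro rfl; omega
  obtain ⟨r, rfl⟩ := Nat.exists_eq_succ_of_ne_zero hk0
  have hp : rotPeriod l ≠ 0 := by intro h; rw [h] at hk; omega
  have e := eq_listPow_take_of_rotate_eq (l := l) (p := rotPeriod l) (k := r)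
    (rotate_eq_iff_rotPeriod_dvd.2 dvd_rfl) (by rw [hk, Nat.mul_comm])
  have hlen : (l.take (rotPeriod l)).length = rotPeriod l := by
    rw [List.length_take]
    exact min_eq_left (Nat.le_of_dvd hpos (rotPeriod_dvd_length l))
  refine ⟨l.take (rotPeriod l), r, ⟨?_, ?_⟩, e.symm⟩
  · intro h
    rw [h] at hlen
    exact hp hlen.symm
  · rw [hlen, ← rotPeriod_listPow_succ _ r, ← e]

/-- The rotation period of the power recovers the length of the root, hence the root as a prefix. -/
theorem listPow_injective_of_aperiodic {P Q : List α} {r s : ℕ} (hP : IsAperiodic P)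
    (hQ : IsAperiodic Q) (h : listPow P (r + 1) = listPow Q (s + 1)) : P = Q ∧ r = s := by
  have hl : P.length = Q.length := by
    rw [← hP.2, ← hQ.2, ← rotPeriod_listPow_succ P r, h, rotPeriod_listPow_succ]
  have hPQ : P = Q := by
    rw [← take_listPow_succ P r, ← take_listPow_succ Q s, h, hl]
  refine ⟨hPQ, ?_⟩
  have := congrArg List.length h
  rw [length_listPow, length_listPow, hl] at this
  have := Nat.eq_of_mul_eq_mul_right hQ.length_pos this
  omega

theorem IsAperiodic.of_isRotated {l l' : List α} (h : IsAperiodic l) (hr : l ~r l') :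
    IsAperiodic l' := by
  obtain ⟨n, rfl⟩ := hr
  refine ⟨?_, ?_⟩
  · rw [Ne, List.rotate_eq_nil_iff]; exact h.1
  · rw [rotPeriod_rotate, h.2, List.length_rotate]

/-- The rotations of an aperiodic list form its rotation class without repetition. -/
theorem IsAperiodic.bijective_rotate {l : List α} (h : IsAperiodic l) :
    Function.Bijective fun i : Fin l.length =>
      (⟨l.rotate i, List.IsRotated.forall l i⟩ : {l' : List α // l' ~r l}) := by
  constructor
  · intro i j hij
    have hij : l.rotate i = l.rotate j := congrArg Subtype.val hij
    rw [← rot_iterate, ← rot_iterate] at hij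
    apply Fin.ext
    exact Function.iterate_injOn_Iio_minimalPeriod (f := rot) (x := l)
      (h.2.symm ▸ i.2 : (i : ℕ) < rotPeriod l) (h.2.symm ▸ j.2 : (j : ℕ) < rotPeriod l) hij
  · rintro ⟨l', hl'⟩
    obtain ⟨n, rfl⟩ := hl'.symm
    refine ⟨⟨n % l.length, Nat.mod_lt _ h.length_pos⟩, ?_⟩
    simp [List.rotate_mod]

end ListPowers

/-! ### Multiplicative weights of cyclic lists -/

section CyclicWeight

variable {α R : Type*} [CommMonoid R]

/-- The product of `W aᵢ aᵢ₊₁` over the cyclically consecutive pairs of `a₁ ⋯ aₗ`. -/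
def cyclicWeight (W : Matrix α α R) (l : List α) : R :=
  ((l.zip (l.rotate 1)).map fun p => W p.1 p.2).prod

theorem cyclicWeight_rotate (W : Matrix α α R) (l : List α) (n : ℕ) :
    cyclicWeight W (l.rotate n) = cyclicWeight W l := by
  have h1 : List.zip (l.rotate n) ((l.rotate n).rotate 1) =
      (List.zip l (l.rotate 1)).rotate n := by
    rw [List.rotate_rotate, Nat.add_comm n 1, ← List.rotate_rotate]
    exact (List.zipWith_rotate_distrib Prod.mk l (l.rotate 1) n (by simp)).symm
  rw [cyclicWeight, h1]
  exact ((List.rotate_perm _ n).map _).prod_eq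

theorem cyclicWeight_congr (W : Matrix α α R) {l l' : List α} (h : l ~r l') :
    cyclicWeight W l = cyclicWeight W l' := by
  obtain ⟨n, rfl⟩ := h
  exact (cyclicWeight_rotate W l n).symm

theorem zip_rotate_one_listPow (P : List α) (r : ℕ) :
    (listPow P r).zip ((listPow P r).rotate 1) = listPow (P.zip (P.rotate 1)) r := by
  rw [rotate_one_listPow]
  induction r with
  | zero => simp
  | succ r ih => rw [listPow_succ, listPow_succ, listPow_succ, List.zip_append (by simp), ih]

theorem cyclicWeight_listPow (W : Matrix α α R) (P : List α) (r : ℕ) :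
    cyclicWeight W (listPow P r) = cyclicWeight W P ^ r := by
  rw [cyclicWeight, zip_rotate_one_listPow, cyclicWeight]
  generalize P.zip (P.rotate 1) = Q
  induction r with
  | zero => simp
  | succ r ih => rw [listPow_succ, List.map_append, List.prod_append, ih, pow_succ']

/-- This expresses being a cycle through the same list of consecutive pairs that defines bumps and
weights. -/
theorem cycle_chain_iff_zip (r : α → α → Prop) (l : List α) :
    Cycle.Chain r (l : Cycle α) ↔ ∀ p ∈ l.zip (l.rotate 1), r p.1 p.2 := by
  cases l with
  | nil => simp
  | cons a t =>
    have key : ∀ (t : List α) (a b : α), List.IsChain r (a :: (t ++ [b])) ↔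
        ∀ p ∈ (a :: t).zip (t ++ [b]), r p.1 p.2 := by
      intro t
      induction t with
      | nil => intro a b; simp
      | cons c t ih =>
        intro a b
        rw [List.cons_append, List.isChain_cons_cons, ih]
        simp
    rw [Cycle.chain_coe_cons, key]
    simp

end CyclicWeight

/-! ### Closed walks and traces of matrix powers -/

section TraceFormula

variable {α R : Type*} [CommSemiring R]

/-- The product of the weights of the steps of the walk from `a` through the list to `b`. -/
def pathWeight (W : Matrix α α R) : α → List α → α → R
  | a, [], b => W a b
  | a, c :: t, b => W a c * pathWeight W c t b

theorem cyclicWeight_cons (W : Matrix α α R) (a : α) (t : List α) :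
    cyclicWeight W (a :: t) = pathWeight W a t a := by
  have key : ∀ (t : List α) (a b : α),
      (((a :: t).zip (t ++ [b])).map fun p => W p.1 p.2).prod = pathWeight W a t b := by
    intro t
    induction t with
    | nil => intro a b; simp [pathWeight]
    | cons c t ih =>
      intro a b
      rw [List.cons_append, List.zip_cons_cons, List.map_cons, List.prod_cons, ih, pathWeight]
  rw [cyclicWeight, ← key]
  simp

theorem sum_ofFn_succ [Fintype α] (n : ℕ) (f : List α → R) :
    ∑ x : Fin (n + 1) → α, f (List.ofFn x) = ∑ a, ∑ y : Fin n → α, f (a :: List.ofFn y) := by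
  rw [← Fintype.sum_prod_type' (f := fun a (y : Fin n → α) => f (a :: List.ofFn y)),
    ← (Fin.consEquiv fun _ => α).sum_comp]
  refine Finset.sum_congr rfl fun p _ => ?_
  rw [List.ofFn_succ]
  simp [Fin.consEquiv]

variable [Fintype α] [DecidableEq α]

theorem sum_pathWeight (W : Matrix α α R) (n : ℕ) (a b : α) :
    ∑ x : Fin n → α, pathWeight W a (List.ofFn x) b = (W ^ (n + 1)) a b := by
  induction n generalizing a with
  | zero => simp [pathWeight]
  | succ n ih =>
    refine (sum_ofFn_succ n fun l => pathWeight W a l b).trans ?_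
    rw [pow_succ', Matrix.mul_apply]
    refine Finset.sum_congr rfl fun c _ => ?_
    rw [← ih, Finset.mul_sum]
    rfl

theorem sum_cyclicWeight (W : Matrix α α R) (n : ℕ) :
    ∑ x : Fin (n + 1) → α, cyclicWeight W (List.ofFn x) = (W ^ (n + 1)).trace := by
  rw [sum_ofFn_succ, Matrix.trace]
  refine Finset.sum_congr rfl fun a _ => ?_
  rw [Matrix.diag_apply, ← sum_pathWeight]
  exact Finset.sum_congr rfl fun y _ => cyclicWeight_cons W a _

end TraceFormula

/-! ### Logarithm of the Euler product as a sum over lists -/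

section EulerProduct

variable {α : Type*}

/-- The weight `q ^ |l| W(l)` of a list. -/
noncomputable def listWeight (W : Matrix α α ℂ) (q : ℂ) (l : List α) : ℂ :=
  q ^ l.length * cyclicWeight W l

theorem listWeight_listPow (W : Matrix α α ℂ) (q : ℂ) (P : List α) (r : ℕ) :
    listWeight W q (listPow P r) = listWeight W q P ^ r := by
  rw [listWeight, listWeight, cyclicWeight_listPow, length_listPow, mul_pow, ← pow_mul,
    Nat.mul_comm]

theorem listWeight_congr (W : Matrix α α ℂ) (q : ℂ) {l l' : List α} (h : l ~r l') :
    listWeight W q l = listWeight W q l' := by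
  rw [listWeight, listWeight, cyclicWeight_congr W h, h.perm.length_eq]

theorem norm_listWeight_le {W : Matrix α α ℂ} {M : ℝ} (hM : ∀ a b, ‖W a b‖ ≤ M)
    (q : ℂ) (l : List α) : ‖listWeight W q l‖ ≤ (‖q‖ * M) ^ l.length := by
  have key : ∀ L : List (α × α), ‖(L.map fun p => W p.1 p.2).prod‖ ≤ M ^ L.length := by
    intro L
    induction L with
    | nil => simp
    | cons p L ih =>
      rw [List.map_cons, List.prod_cons, norm_mul, List.length_cons, pow_succ']
      exact mul_le_mul (hM _ _) ih (norm_nonneg _) ((norm_nonneg _).trans (hM p.1 p.2))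
  have h := key (l.zip (l.rotate 1))
  rw [List.length_zip, List.length_rotate, min_self] at h
  rw [listWeight, norm_mul, norm_pow, mul_pow, cyclicWeight]
  gcongr

/-- The weight `q ^ |l| W(l) / |l|` of a rooted cyclic list. -/
noncomputable def rootedWeight (W : Matrix α α ℂ) (q : ℂ) (l : List α) : ℂ :=
  listWeight W q l / l.length

/-- The lists of length `n` contribute at most `(‖q‖ M |α|) ^ n`. The `+ 1` in the hypothesis also
gives `‖q‖ M < 1`, which the logarithms need later. -/
theorem summable_rootedWeight [Fintype α] {W : Matrix α α ℂ} {M : ℝ} (hM : ∀ a b, ‖W a b‖ ≤ M)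
    (hM0 : 0 ≤ M) {q : ℂ} (hq : ‖q‖ * M * (Fintype.card α + 1) < 1) : Summable (rootedWeight W q) := by
  have ht : 0 ≤ ‖q‖ * M := by positivity
  rw [← List.equivSigmaTuple.symm.summable_iff]
  apply Summable.of_norm_bounded (g := fun x : Σ n, Fin n → α => (‖q‖ * M) ^ x.1)
  · rw [summable_sigma_of_nonneg (fun x => by positivity)]
    refine ⟨fun n => Summable.of_finite, ?_⟩
    have : Summable fun n : ℕ => (‖q‖ * M * Fintype.card α) ^ n := by
      apply summable_geometric_of_lt_one (by positivity)
      nlinarith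
    refine this.congr fun n => ?_
    simp [tsum_fintype, mul_pow, mul_comm]
  · rintro ⟨n, x⟩
    have h := norm_listWeight_le hM q (List.ofFn x)
    rw [List.length_ofFn] at h
    change ‖rootedWeight W q (List.ofFn x)‖ ≤ _
    rw [rootedWeight, norm_div, List.length_ofFn, RCLike.norm_natCast]
    refine le_trans ?_ h
    rcases n with _ | n
    · simp
    · apply div_le_self (norm_nonneg _)
      push_cast
      linarith [(Nat.cast_nonneg n : (0 : ℝ) ≤ n)]

/-- The rotation classes of aperiodic lists. -/
def IsAperiodicCycle (C : Cycle α) : Prop := ∃ l : List α, IsAperiodic l ∧ (l : Cycle α) = C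

theorem isAperiodicCycle_coe {l : List α} : IsAperiodicCycle (l : Cycle α) ↔ IsAperiodic l :=
  ⟨fun ⟨_, hl', h⟩ => hl'.of_isRotated (Cycle.coe_eq_coe.1 h), fun h => ⟨l, h, rfl⟩⟩

/-- The class of an aperiodic `l` has exactly `|l|` members, which cancels the division by the
length. -/
theorem hasSum_aperiodicCycle {H : Cycle α → ℂ} {S : ℂ}
    (h : HasSum (fun P : {l : List α // IsAperiodic l} => H P.1 / (P.1.length : ℂ)) S) :
    HasSum (fun C : {C : Cycle α // IsAperiodicCycle C} => H C.1) S := by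
  set φ : {l : List α // IsAperiodic l} → {C : Cycle α // IsAperiodicCycle C} :=
    fun P => ⟨P.1, P.1, P.2, rfl⟩ with hφ
  rw [← (Equiv.sigmaFiberEquiv φ).hasSum_iff] at h
  refine h.sigma fun C => ?_
  obtain ⟨_, l, hl, rfl⟩ := C
  have hmem (x : {l' : List α // l' ~r l}) : φ ⟨x.1, hl.of_isRotated x.2.symm⟩ = φ ⟨l, hl⟩ :=
    Subtype.ext (Cycle.coe_eq_coe.2 x.2)
  let e : {l' : List α // l' ~r l} ≃ {x // φ x = φ ⟨l, hl⟩} :=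
    { toFun := fun x => ⟨⟨x.1, hl.of_isRotated x.2.symm⟩, hmem x⟩
      invFun := fun x => ⟨x.1.1, Cycle.coe_eq_coe.1 (congrArg Subtype.val x.2)⟩
      left_inv := fun _ => rfl
      right_inv := fun _ => rfl }
  let e' := (Equiv.ofBijective _ hl.bijective_rotate).trans e
  rw [← e'.hasSum_iff]
  convert hasSum_fintype _ using 1
  have : ∀ i : Fin l.length, H ((l.rotate i : List α) : Cycle α) / ((l.rotate i).length : ℂ) =
      H l / (l.length : ℂ) := by
    intro i
    rw [List.length_rotate, Cycle.coe_eq_coe.2 (List.IsRotated.forall l i)]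
  change H l = ∑ i : Fin l.length, H ((l.rotate i : List α) : Cycle α) / ((l.rotate i).length : ℂ)
  rw [Finset.sum_congr rfl fun i _ => this i, Finset.sum_const, Finset.card_univ,
    Fintype.card_fin, nsmul_eq_mul, mul_div_cancel₀]
  exact Nat.cast_ne_zero.2 hl.length_pos.ne'

variable [Fintype α] [DecidableEq α]

theorem hasSum_rootedWeight {W : Matrix α α ℂ} {M : ℝ} (hM : ∀ a b, ‖W a b‖ ≤ M) (hM0 : 0 ≤ M)
    {q : ℂ} (hq : ‖q‖ * M * (Fintype.card α + 1) < 1) {S : ℂ}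
    (hS : HasSum (fun n : ℕ => (W ^ n).trace * q ^ n / n) S) :
    HasSum (rootedWeight W q) S := by
  have hsum := summable_rootedWeight hM hM0 hq
  rw [← List.equivSigmaTuple.symm.hasSum_iff]
  refine HasSum.sigma_of_hasSum hS (fun n => ?_) (List.equivSigmaTuple.symm.summable_iff.2 hsum)
  convert hasSum_fintype _ using 1
  change _ = ∑ x : Fin n → α, rootedWeight W q (List.ofFn x)
  rcases n with _ | n
  -- Both sides are quotients by 0, so the empty list and `W ^ 0` contribute 0.
  · simp [rootedWeight]
  · rw [← sum_cyclicWeight, Finset.sum_mul, Finset.sum_div]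
    refine Finset.sum_congr rfl fun x _ => ?_
    rw [rootedWeight, listWeight, List.length_ofFn, mul_comm]

/-- Group the nonempty lists by their aperiodic root. With `z` the weight of `P`, its powers
contribute `∑ z ^ r / (r |P|)` over `r ≥ 1`, a logarithm series. -/
theorem hasSum_aperiodic {W : Matrix α α ℂ} {M : ℝ} (hM : ∀ a b, ‖W a b‖ ≤ M) (hM0 : 0 ≤ M)
    {q : ℂ} (hq : ‖q‖ * M * (Fintype.card α + 1) < 1) {S : ℂ}
    (hS : HasSum (fun n : ℕ => (W ^ n).trace * q ^ n / n) S) :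
    HasSum (fun P : {l : List α // IsAperiodic l} =>
      -Complex.log (1 - listWeight W q P) / (P.1.length : ℂ)) S := by
  have h := hasSum_rootedWeight hM hM0 hq hS
  have hinj : Function.Injective
      fun x : {l : List α // IsAperiodic l} × ℕ => listPow x.1.1 (x.2 + 1) := by
    rintro ⟨⟨P, hP⟩, r⟩ ⟨⟨Q, hQ⟩, s⟩ hx
    obtain ⟨rfl, rfl⟩ := listPow_injective_of_aperiodic hP hQ hx
    rfl
  rw [← hinj.hasSum_iff] at h
  · refine h.prod_fiberwise fun ⟨P, hP⟩ => ?_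
    have hlt : ‖listWeight W q P‖ < 1 := by
      refine (norm_listWeight_le hM q P).trans_lt ?_
      have ht : 0 ≤ ‖q‖ * M := by positivity
      apply pow_lt_one₀ ht _ hP.length_pos.ne'
      nlinarith [(Nat.cast_nonneg (Fintype.card α) : (0 : ℝ) ≤ _)]
    have hlog := (Complex.hasSum_taylorSeries_neg_log hlt)
    -- The vanishing term of index 0 is dropped, so that the index `r` stands for the power `r + 1`.
    rw [← hasSum_nat_add_iff' 1] at hlog
    have hlog' := hlog.div_const (P.length : ℂ)
    simp only [Finset.range_one, Finset.sum_singleton, Nat.cast_zero, div_zero, sub_zero] at hlog'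
    refine hlog'.congr_fun ?_
    intro r
    simp only [Function.comp_apply, rootedWeight, listWeight_listPow, length_listPow,
      Nat.cast_mul, div_div]
  · intro l hl
    by_cases h0 : l = []
    · simp [h0, rootedWeight]
    · obtain ⟨P, r, hP, rfl⟩ := exists_aperiodic_root h0
      exact absurd ⟨(⟨P, hP⟩, r), rfl⟩ hl

/-- The Euler product over the aperiodic rotation classes of lists. -/
theorem hasProd_aperiodicCycle {W : Matrix α α ℂ} {M : ℝ} (hM : ∀ a b, ‖W a b‖ ≤ M)
    (hM0 : 0 ≤ M) {q : ℂ} (hq : ‖q‖ * M * (Fintype.card α + 1) < 1) {S : ℂ}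
    (hS : HasSum (fun n : ℕ => (W ^ n).trace * q ^ n / n) S) {z : Cycle α → ℂ}
    (hz : ∀ l : List α, z l = listWeight W q l) :
    HasProd (fun C : {C : Cycle α // IsAperiodicCycle C} => (1 - z C.1)⁻¹) (Complex.exp S) := by
  have h := hasSum_aperiodic hM hM0 hq hS
  simp only [← hz] at h
  have h' := (hasSum_aperiodicCycle (H := fun C => -Complex.log (1 - z C)) h).cexp
  refine h'.congr_fun ?_
  rintro ⟨_, l, hl, rfl⟩
  have hlt : ‖z l‖ < 1 := by
    rw [hz]
    refine (norm_listWeight_le hM q l).trans_lt ?_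
    have ht : 0 ≤ ‖q‖ * M := by positivity
    apply pow_lt_one₀ ht _ hl.length_pos.ne'
    nlinarith [(Nat.cast_nonneg (Fintype.card α) : (0 : ℝ) ≤ _)]
  have hne : 1 - z l ≠ 0 := by
    intro h0
    rw [← sub_eq_zero.1 h0] at hlt
    simp at hlt
  simp [Complex.exp_neg, Complex.exp_log hne]

end EulerProduct

/-! ### Determinants and traces through eigenvalues -/

section SpectralMapping

open Polynomial

variable {K n : Type*} [Field K] [IsAlgClosed K] [Fintype n] [DecidableEq n]

theorem eval_charpoly_eq_prod_roots (W : Matrix n n K) (x : K) :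
    (W.charpoly.roots.map fun μ => x - μ).prod = (Matrix.scalar n x - W).det := by
  have h := (IsAlgClosed.splits W.charpoly).eq_prod_roots
  rw [W.charpoly_monic.leadingCoeff, C_1, one_mul] at h
  rw [← Matrix.eval_charpoly]
  conv_rhs => rw [h]
  rw [eval_multiset_prod, Multiset.map_map]
  simp

theorem card_roots_charpoly (W : Matrix n n K) :
    W.charpoly.roots.card = Fintype.card n := by
  rw [← (IsAlgClosed.splits W.charpoly).natDegree_eq_card_roots, Matrix.charpoly_natDegree_eq_dim]

/-- The determinant of `g(W)` is the product of `g(μ)` over the eigenvalues `μ` of `W`. -/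
theorem det_aeval_eq_prod_roots (W : Matrix n n K) (g : K[X]) :
    (aeval W g).det = (W.charpoly.roots.map fun μ => g.eval μ).prod := by
  have h := (IsAlgClosed.splits g).eq_prod_roots
  rw [h]
  generalize g.roots = s
  generalize g.leadingCoeff = c
  induction s using Multiset.induction with
  | empty => simp [card_roots_charpoly, Matrix.algebraMap_eq_diagonal]
  | cons a s ih =>
    have e : C c * (Multiset.map (fun x => X - C x) (a ::ₘ s)).prod =
        (X - C a) * (C c * (Multiset.map (fun x => X - C x) s).prod) := by
      rw [Multiset.map_cons, Multiset.prod_cons]; ring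
    rw [e, map_mul, Matrix.det_mul, ih]
    simp only [eval_mul, Multiset.prod_map_mul]
    congr 1
    have h1 : aeval W (X - C a) = -(Matrix.scalar n a - W) := by
      simp [Matrix.algebraMap_eq_diagonal, Matrix.scalar_apply]
    rw [h1, Matrix.det_neg, ← eval_charpoly_eq_prod_roots, ← card_roots_charpoly W,
      ← Multiset.card_map (fun μ => a - μ), ← Multiset.prod_map_neg, Multiset.map_map]
    simp

/-- The trace of `W ^ k` is the sum of the `k`-th powers of the eigenvalues of `W`. -/
theorem trace_pow_eq_sum_roots (W : Matrix n n K) (k : ℕ) :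
    (W ^ k).trace = (W.charpoly.roots.map fun μ => μ ^ k).sum := by
  have h : (W ^ k).charpoly = ((W.charpoly.roots.map fun μ => μ ^ k).map fun a => X - C a).prod := by
    apply Polynomial.funext
    intro x
    -- This evaluates the characteristic polynomial of `W ^ k` at `x` as `∏ (x - μ ^ k)`.
    have h2 := det_aeval_eq_prod_roots W (C x - X ^ k)
    rw [Matrix.eval_charpoly, eval_multiset_prod, Multiset.map_map, Multiset.map_map]
    simpa [Matrix.algebraMap_eq_diagonal, Matrix.scalar_apply, Pi.algebraMap_def] using h2
  rw [Matrix.trace_eq_sum_roots_charpoly, h, roots_multiset_prod_X_sub_C]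

theorem det_one_sub_smul_eq_prod_roots (W : Matrix n n K) (q : K) :
    (1 - q • W).det = (W.charpoly.roots.map fun μ => 1 - q * μ).prod := by
  have h2 := det_aeval_eq_prod_roots W (1 - C q * X)
  simpa [Algebra.smul_def] using h2

end SpectralMapping

/-! ### The Euler product over aperiodic classes as a determinant -/

section LogDet

theorem hasSum_sum_pow_div (s : Multiset ℂ) (q : ℂ) (hs : ∀ μ ∈ s, ‖q * μ‖ < 1) :
    HasSum (fun k : ℕ => (s.map fun μ => μ ^ k).sum * q ^ k / k)
      (s.map fun μ => -Complex.log (1 - q * μ)).sum := by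
  induction s using Multiset.induction with
  | empty => simp
  | cons a s ih =>
    have h1 := Complex.hasSum_taylorSeries_neg_log (hs a (Multiset.mem_cons_self a s))
    have h2 := h1.add (ih fun μ hμ => hs μ (Multiset.mem_cons_of_mem hμ))
    rw [Multiset.map_cons, Multiset.sum_cons]
    refine h2.congr_fun fun k => ?_
    rw [Multiset.map_cons, Multiset.sum_cons, mul_pow]
    ring

theorem exp_sum_neg_log (s : Multiset ℂ) (q : ℂ) (hs : ∀ μ ∈ s, ‖q * μ‖ < 1) :
    Complex.exp (s.map fun μ => -Complex.log (1 - q * μ)).sum =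
      (s.map fun μ => 1 - q * μ).prod⁻¹ := by
  induction s using Multiset.induction with
  | empty => simp
  | cons a s ih =>
    have ha : 1 - q * a ≠ 0 := by
      intro h0
      have := hs a (Multiset.mem_cons_self a s)
      rw [← sub_eq_zero.1 h0] at this
      simp at this
    rw [Multiset.map_cons, Multiset.sum_cons, Multiset.map_cons, Multiset.prod_cons,
      Complex.exp_add, ih fun μ hμ => hs μ (Multiset.mem_cons_of_mem hμ), Complex.exp_neg,
      Complex.exp_log ha, mul_inv]

variable {α : Type*} [Fintype α] [DecidableEq α]

/-- For small `q` the Euler product over the aperiodic rotation classes of lists equals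
`det (1 - q W)⁻¹`. -/
theorem eventually_hasProd_aperiodicCycle (W : Matrix α α ℂ) {z : ℂ → Cycle α → ℂ}
    (hz : ∀ (q : ℂ) (l : List α), z q l = listWeight W q l) :
    ∀ᶠ q in nhds (0 : ℂ),
      HasProd (fun C : {C : Cycle α // IsAperiodicCycle C} => (1 - z q C.1)⁻¹)
        (1 - q • W).det⁻¹ := by
  set M : ℝ := ∑ a, ∑ b, ‖W a b‖ with hMdef
  have hM : ∀ a b, ‖W a b‖ ≤ M := fun a b =>
    (Finset.single_le_sum (f := fun b => ‖W a b‖) (fun _ _ => norm_nonneg _)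
      (Finset.mem_univ b)).trans
    (Finset.single_le_sum (f := fun a => ∑ b, ‖W a b‖)
      (fun _ _ => Finset.sum_nonneg fun _ _ => norm_nonneg _) (Finset.mem_univ a))
  have hM0 : 0 ≤ M := Finset.sum_nonneg fun _ _ => Finset.sum_nonneg fun _ _ => norm_nonneg _
  have h1 : ∀ᶠ q in nhds (0 : ℂ), ‖q‖ * M * (Fintype.card α + 1) < 1 := by
    have hc : Continuous fun q : ℂ => ‖q‖ * M * (Fintype.card α + 1) := by fun_prop
    exact hc.continuousAt.eventually_lt continuousAt_const (by simp)
  have h2 : ∀ᶠ q in nhds (0 : ℂ), ∀ μ ∈ W.charpoly.roots.toFinset, ‖q * μ‖ < 1 := by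
    rw [Filter.eventually_all_finset]
    intro μ _
    have hc : Continuous fun q : ℂ => ‖q * μ‖ := by fun_prop
    exact hc.continuousAt.eventually_lt continuousAt_const (by simp)
  filter_upwards [h1, h2] with q hq1 hq2
  have hq2' : ∀ μ ∈ W.charpoly.roots, ‖q * μ‖ < 1 := fun μ hμ =>
    hq2 μ (Multiset.mem_toFinset.2 hμ)
  have hS := hasSum_sum_pow_div _ q hq2'
  simp only [← trace_pow_eq_sum_roots] at hS
  have h := hasProd_aperiodicCycle hM hM0 hq1 hS (hz q)
  rwa [exp_sum_neg_log _ q hq2', ← det_one_sub_smul_eq_prod_roots] at h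

end LogDet

/-! ### Primitive cycles and aperiodic classes -/

section Primitive

variable {V : Type*} {G : SimpleGraph V}

theorem isCycle_of_listPow {P : List G.Dart} {r : ℕ} (hP : P ≠ [])
    (h : Cycle.Chain G.DartAdj (listPow P (r + 1) : Cycle G.Dart)) :
    IsCycle (P : Cycle G.Dart) := by
  refine ⟨by simpa using hP, ?_⟩
  rw [cycle_chain_iff_zip, zip_rotate_one_listPow, listPow_succ] at h
  rw [cycle_chain_iff_zip]
  exact fun p hp => h p (List.mem_append_left _ hp)

/-- The primitive cycles are the aperiodic ones. -/
theorem isCycle_and_isPrimitive_iff (C : Cycle G.Dart) :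
    IsCycle C ∧ IsPrimitive C ↔ IsAperiodicCycle C ∧ C.Chain G.DartAdj := by
  obtain ⟨l, rfl⟩ : ∃ l : List G.Dart, (l : Cycle G.Dart) = C := Quot.exists_rep C
  rw [isAperiodicCycle_coe]
  constructor
  · rintro ⟨⟨hne, hch⟩, hprim⟩
    refine ⟨?_, hch⟩
    have hne : l ≠ [] := by simpa using hne
    obtain ⟨P, r, hP, rfl⟩ := exists_aperiodic_root hne
    rcases r with _ | r
    · simpa [listPow] using hP
    · exact absurd rfl (hprim P (r + 1 + 1) (isCycle_of_listPow hP.1 hch) (by omega))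
  · rintro ⟨hl, hch⟩
    refine ⟨⟨by simpa using hl.1, hch⟩, ?_⟩
    intro P r hP hr heq
    have h := hl.of_isRotated (Cycle.coe_eq_coe.1 heq)
    obtain ⟨s, rfl⟩ : ∃ s, r = s + 1 := ⟨r - 1, by omega⟩
    change IsAperiodic (listPow P (s + 1)) at h
    have hP0 : 0 < P.length := List.length_pos_iff.2 (by simpa using hP.1)
    have h2 := h.2
    rw [rotPeriod_listPow_succ, length_listPow] at h2
    -- The power is aperiodic, so its length `(s + 1) |P|` is the rotation period of `P`, hence at
    -- most `|P|`. This contradicts `s + 1 ≥ 2`.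
    have h3 := Nat.le_of_dvd hP0 (rotPeriod_dvd_length P)
    nlinarith

end Primitive

/-! ### The zeta function as a reciprocal determinant -/

section DartWeight

variable {V : Type*} [DecidableEq V] {G : SimpleGraph V}

/-- The weighted adjacency matrix of the darts: the entry at `(a, b)` is `u` if `b = a⁻¹`, it is `1`
for the other `b` that can follow `a`, and `0` otherwise. -/
def dartWeight (G : SimpleGraph V) (u : ℂ) : Matrix G.Dart G.Dart ℂ :=
  fun a b => if a.snd = b.fst then if b = a.symm then u else 1 else 0

theorem cyclicWeight_dartWeight_of_chain (u : ℂ) {l : List G.Dart}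
    (h : Cycle.Chain G.DartAdj (l : Cycle G.Dart)) :
    cyclicWeight (dartWeight G u) l = u ^ listBumps l := by
  rw [cycle_chain_iff_zip] at h
  rw [cyclicWeight, listBumps]
  generalize l.zip (l.rotate 1) = Q at h
  induction Q with
  | nil => simp
  | cons p Q ih =>
    have hp : p.1.snd = p.2.fst := h p List.mem_cons_self
    rw [List.map_cons, List.prod_cons, ih fun p hp => h p (List.mem_cons_of_mem _ hp),
      List.countP_cons]
    by_cases hs : p.2 = p.1.symm
    · simp [dartWeight, hs, pow_succ']
    · simp [dartWeight, hs, hp]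

theorem cyclicWeight_dartWeight_of_not_chain (u : ℂ) {l : List G.Dart}
    (h : ¬ Cycle.Chain G.DartAdj (l : Cycle G.Dart)) :
    cyclicWeight (dartWeight G u) l = 0 := by
  rw [cycle_chain_iff_zip] at h
  push Not at h
  obtain ⟨p, hp, hn⟩ := h
  apply List.prod_eq_zero
  rw [List.mem_map]
  exact ⟨p, hp, if_neg hn⟩

/-- The weight `q ^ |C| W(C)` of a rotation class. -/
noncomputable def cycleWeight {α : Type*} (W : Matrix α α ℂ) (q : ℂ) (C : Cycle α) : ℂ :=
  Quotient.liftOn' C (listWeight W q) fun _ _ h => listWeight_congr W q h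

/-- Two versions of the zeta function agree in a punctured neighbourhood of every point. -/
theorem IsBartholdiZeta.eventuallyEq {u : ℂ} {ζ ζ' : ℂ → ℂ} (h : IsBartholdiZeta G u ζ)
    (h' : IsBartholdiZeta G u ζ') (x : ℂ) : ζ =ᶠ[nhdsWithin x {x}ᶜ] ζ' := by
  have hm : Meromorphic (ζ - ζ') := fun y => (h.1 y).sub (h'.1 y)
  have h0 : meromorphicOrderAt (ζ - ζ') 0 = ⊤ := by
    rw [meromorphicOrderAt_eq_top_iff]
    apply Filter.Eventually.filter_mono nhdsWithin_le_nhds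
    filter_upwards [h.2, h'.2] with q hq hq'
    exact sub_eq_zero.2 (hq.unique hq')
  -- Identity theorem: a function meromorphic on `ℂ` has infinite order everywhere or nowhere.
  have hx : meromorphicOrderAt (ζ - ζ') x = ⊤ := by
    by_contra hne
    exact hm.exists_meromorphicOrderAt_ne_top_iff_forall.1 ⟨x, hne⟩ 0 h0
  rw [meromorphicOrderAt_eq_top_iff] at hx
  filter_upwards [hx] with q hq
  exact sub_eq_zero.1 hq

variable [Fintype V] [DecidableRel G.Adj]

/-- Aperiodic classes that are not cycles of `G` have weight 0, so their Euler factors are 1 and can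
be dropped. -/
theorem eventually_hasProd_primitiveCycle (u : ℂ) :
    ∀ᶠ q in nhds (0 : ℂ),
      HasProd (fun C : PrimitiveCycle G => (1 - q ^ C.1.length * u ^ bumps C.1)⁻¹)
        (1 - q • dartWeight G u).det⁻¹ := by
  filter_upwards [eventually_hasProd_aperiodicCycle (dartWeight G u)
    (z := cycleWeight (dartWeight G u)) fun q l => rfl] with q h
  let ι : PrimitiveCycle G → {C : Cycle G.Dart // IsAperiodicCycle C} :=
    fun C => ⟨C.1, ((isCycle_and_isPrimitive_iff C.1).1 C.2).1⟩
  have hι : Function.Injective ι := fun C C' hC => Subtype.ext (by simpa [ι] using hC)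
  rw [← hι.hasProd_iff] at h
  · refine h.congr_fun ?_
    rintro ⟨C, hC⟩
    have hch := hC.1.2
    obtain ⟨l, rfl⟩ : ∃ l : List G.Dart, (l : Cycle G.Dart) = C := Quot.exists_rep C
    have := cyclicWeight_dartWeight_of_chain u hch
    change (1 - q ^ l.length * u ^ listBumps l)⁻¹ = (1 - listWeight (dartWeight G u) q l)⁻¹
    rw [listWeight, this]
  · rintro ⟨C, hC⟩ hn
    have hch : ¬ C.Chain G.DartAdj := fun hch =>
      hn ⟨⟨C, (isCycle_and_isPrimitive_iff C).2 ⟨hC, hch⟩⟩, rfl⟩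
    obtain ⟨l, rfl⟩ : ∃ l : List G.Dart, (l : Cycle G.Dart) = C := Quot.exists_rep C
    change (1 - listWeight (dartWeight G u) q l)⁻¹ = 1
    rw [listWeight, cyclicWeight_dartWeight_of_not_chain u hch]
    simp

theorem meromorphic_det_inv {α : Type*} [Fintype α] [DecidableEq α] (W : Matrix α α ℂ) :
    Meromorphic fun q : ℂ => (1 - q • W).det⁻¹ := by
  have h : (fun q : ℂ => (1 - q • W).det) = fun q => W.charpolyRev.eval q := by
    funext q
    rw [Matrix.charpolyRev, ← Polynomial.coe_evalRingHom, RingHom.map_det]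
    congr 1
    ext i j
    simp [Matrix.one_apply, apply_ite, Matrix.smul_apply]
    exact mul_comm _ _
  intro x
  have hp : AnalyticAt ℂ (fun q => W.charpolyRev.eval q) x :=
    W.charpolyRev.differentiable.analyticAt x
  rw [← h] at hp
  exact hp.meromorphicAt.inv

theorem isBartholdiZeta_det_inv (u : ℂ) :
    IsBartholdiZeta G u fun q => (1 - q • dartWeight G u).det⁻¹ :=
  ⟨meromorphic_det_inv _, eventually_hasProd_primitiveCycle u⟩

end DartWeight

/-! ### Bartholdi's determinant formula -/

section DeterminantFormula

open Matrix

variable {V : Type*} {G : SimpleGraph V}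

/-- The dart that runs along an oriented edge. -/
def EdgeOrientation.dart (o : EdgeOrientation G) (e : G.edgeSet) : G.Dart :=
  ⟨(o.src e, o.tgt e), by rw [← SimpleGraph.mem_edgeSet, o.edge_eq]; exact e.2⟩

theorem EdgeOrientation.edge_dart (o : EdgeOrientation G) (e : G.edgeSet) :
    (o.dart e).edge = e := o.edge_eq e

theorem EdgeOrientation.bijective_darts (o : EdgeOrientation G) :
    Function.Bijective (Sum.elim o.dart fun e => (o.dart e).symm) := by
  have hedge (x : G.edgeSet ⊕ G.edgeSet) :
      (Sum.elim o.dart (fun e => (o.dart e).symm) x).edge = (Sum.elim id id x : G.edgeSet) := by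
    rcases x with e | e <;> simp [o.edge_dart]
  constructor
  · intro x y hxy
    have h := hedge x
    rw [hxy, hedge y] at h
    have h := Subtype.ext h
    rcases x with e | e <;> rcases y with f | f <;> simp only [Sum.elim_inl, Sum.elim_inr, id] at h
    · rw [h]
    · subst h
      exact absurd hxy.symm (SimpleGraph.Dart.symm_ne _)
    · subst h
      exact absurd hxy (SimpleGraph.Dart.symm_ne _)
    · rw [h]
  · intro d
    have h : d.edge = (o.dart ⟨d.edge, d.edge_mem⟩).edge := (o.edge_dart ⟨d.edge, d.edge_mem⟩).symm
    rcases (SimpleGraph.dart_edge_eq_iff _ _).1 h with h | h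
    · exact ⟨Sum.inl _, h.symm⟩
    · exact ⟨Sum.inr _, h.symm⟩

/-- The darts are the oriented edges and their inverses. -/
noncomputable def EdgeOrientation.sumEquivDart (o : EdgeOrientation G) :
    G.edgeSet ⊕ G.edgeSet ≃ G.Dart := Equiv.ofBijective _ o.bijective_darts

variable [Fintype V] [DecidableRel G.Adj]

theorem EdgeOrientation.sum_darts {M : Type*} [AddCommMonoid M] (o : EdgeOrientation G)
    (f : G.Dart → M) :
    ∑ d, f d = ∑ e, (f (o.dart e) + f (o.dart e).symm) := by
  rw [← o.sumEquivDart.sum_comp, Fintype.sum_sum_type, ← Finset.sum_add_distrib]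
  rfl

variable [DecidableEq V]

theorem sum_darts_fst_snd {R : Type*} [NonAssocSemiring R] (v w : V) :
    (∑ d : G.Dart, if v = d.fst ∧ w = d.snd then (1 : R) else 0) = G.adjMatrix R v w := by
  rw [SimpleGraph.adjMatrix_apply]
  split_ifs with h
  · rw [Finset.sum_eq_single (⟨(v, w), h⟩ : G.Dart)]
    · simp
    · intro d _ hd
      rw [if_neg]
      rintro ⟨rfl, rfl⟩
      exact hd rfl
    · simp
  · apply Finset.sum_eq_zero
    intro d _
    rw [if_neg]
    rintro ⟨rfl, rfl⟩
    exact h d.adj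

theorem sum_darts_fst_fst {R : Type*} [NonAssocSemiring R] (v w : V) :
    (∑ d : G.Dart, if v = d.fst ∧ w = d.fst then (1 : R) else 0) = G.degMatrix R v w := by
  rw [SimpleGraph.degMatrix, Matrix.diagonal_apply]
  split_ifs with h
  · subst h
    simp only [and_self, Finset.sum_boole]
    rw [← G.dart_fst_fiber_card_eq_degree v]
    simp only [eq_comm]
  · apply Finset.sum_eq_zero
    intro d _
    rw [if_neg]
    rintro ⟨rfl, rfl⟩
    exact h rfl

/-- The permutation matrix of the inversion of darts. -/
def invMatrix (G : SimpleGraph V) (R : Type*) [Zero R] [One R] : Matrix G.Dart G.Dart R :=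
  fun a b => if a.symm = b then 1 else 0

/-- The incidence matrix of darts and their sources. -/
def fstMatrix (G : SimpleGraph V) (R : Type*) [Zero R] [One R] : Matrix V G.Dart R :=
  fun v d => if v = d.fst then 1 else 0

/-- The incidence matrix of darts and their targets. -/
def sndMatrix (G : SimpleGraph V) (R : Type*) [Zero R] [One R] : Matrix G.Dart V R :=
  fun d v => if v = d.snd then 1 else 0

/-- The product factors through the vertices. Together with Sylvester's identity this reduces a
determinant over darts to one over vertices. -/
theorem dartWeight_eq {V : Type*} [Fintype V] [DecidableEq V] (G : SimpleGraph V) (u : ℂ) :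
    dartWeight G u = sndMatrix G ℂ * fstMatrix G ℂ - (1 - u) • invMatrix G ℂ := by
  ext a b
  by_cases h : b = a.symm
  · simp [dartWeight, sndMatrix, fstMatrix, invMatrix, Matrix.mul_apply, h]
  · have h' : a.symm ≠ b := fun hab => h hab.symm
    by_cases hf : a.snd = b.fst
    · simp [dartWeight, sndMatrix, fstMatrix, invMatrix, Matrix.mul_apply, h, h', hf]
    · simp [dartWeight, sndMatrix, fstMatrix, invMatrix, Matrix.mul_apply, h', hf, Ne.symm hf]

theorem invMatrix_mul_apply {R m : Type*} [NonAssocSemiring R] (N : Matrix G.Dart m R)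
    (d : G.Dart) (j : m) : (invMatrix G R * N) d j = N d.symm j := by
  simp [Matrix.mul_apply, invMatrix]

theorem invMatrix_mul_self {R : Type*} [NonAssocSemiring R] : invMatrix G R * invMatrix G R = 1 := by
  ext a b
  rw [invMatrix_mul_apply, invMatrix, Matrix.one_apply]
  simp

theorem fstMatrix_mul_sndMatrix {R : Type*} [NonAssocSemiring R] :
    fstMatrix G R * sndMatrix G R = G.adjMatrix R := by
  ext v w
  rw [← sum_darts_fst_snd, Matrix.mul_apply]
  refine Finset.sum_congr rfl fun d _ => ?_
  by_cases h : v = d.fst <;> simp [fstMatrix, sndMatrix, h]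

theorem fstMatrix_mul_invMatrix_mul_sndMatrix {R : Type*} [NonAssocSemiring R] :
    fstMatrix G R * (invMatrix G R * sndMatrix G R) = G.degMatrix R := by
  ext v w
  rw [← sum_darts_fst_fst, Matrix.mul_apply]
  refine Finset.sum_congr rfl fun d _ => ?_
  by_cases h : v = d.fst <;> simp [invMatrix_mul_apply, fstMatrix, sndMatrix, h]

/-- Inversion swaps the oriented edges with their inverses, so in these blocks it is antidiagonal.
-/
theorem det_one_add_smul_invMatrix (o : EdgeOrientation G) (x : ℂ) :
    (1 + x • invMatrix G ℂ).det = (1 - x ^ 2) ^ nE G := by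
  have h : (1 + x • invMatrix G ℂ).submatrix o.sumEquivDart o.sumEquivDart =
      Matrix.fromBlocks 1 (x • 1) (x • 1) 1 := by
    have hl (e : G.edgeSet) : o.sumEquivDart (Sum.inl e) = o.dart e := rfl
    have hr (e : G.edgeSet) : o.sumEquivDart (Sum.inr e) = (o.dart e).symm := rfl
    have hs (e : G.edgeSet) : (o.sumEquivDart (Sum.inl e)).symm = o.sumEquivDart (Sum.inr e) := rfl
    have hs' (e : G.edgeSet) : (o.sumEquivDart (Sum.inr e)).symm = o.sumEquivDart (Sum.inl e) := by
      rw [hl, hr, SimpleGraph.Dart.symm_symm]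
    ext i j
    rcases i with i | i <;> rcases j with j | j <;>
      simp [Matrix.one_apply, invMatrix, hs, hs']
  rw [← Matrix.det_submatrix_equiv_self o.sumEquivDart, h, Matrix.det_fromBlocks_one₁₁]
  have h2 : (1 : Matrix G.edgeSet G.edgeSet ℂ) - (x • 1) * (x • 1) = (1 - x ^ 2) • 1 := by
    rw [smul_mul_smul_comm, Matrix.one_mul, sub_smul, one_smul, pow_two]
  rw [h2, Matrix.det_smul, Matrix.det_one, mul_one, nE, SimpleGraph.edgeFinset_card]

/-- The determinant formula of Bartholdi. -/
theorem det_one_sub_smul_dartWeight (o : EdgeOrientation G) (u q : ℂ)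
    (hx : 1 - (q * (1 - u)) ^ 2 ≠ 0) :
    (1 - q • dartWeight G u).det * ((1 - u) * (1 - (q * (1 - u)) ^ 2)) ^ nV V =
      (1 - (q * (1 - u)) ^ 2) ^ nE G *
        (((1 - u) * (1 - (q * (1 - u)) ^ 2)) • (1 : Matrix V V ℂ) -
          (q * (1 - u)) • G.adjMatrix ℂ + (q * (1 - u)) ^ 2 • G.degMatrix ℂ).det := by
  set w := 1 - u with hw
  set x := q * w with hxdef
  set J := invMatrix G ℂ
  set T := sndMatrix G ℂ
  set S := fstMatrix G ℂ
  -- Since `J² = 1`, this is the inverse of `1 + x J`.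
  set R := (1 - x ^ 2)⁻¹ • (1 - x • J) with hR
  have hJ : J * J = 1 := invMatrix_mul_self
  have h1 : (1 + x • J) * R = 1 := by
    have : (1 + x • J) * (1 - x • J) = (1 - x ^ 2) • 1 := by
      rw [mul_sub, add_mul, add_mul, smul_mul_smul_comm, hJ, sub_smul, one_smul, pow_two]
      simp only [mul_one, one_mul]
      abel
    rw [hR, Matrix.mul_smul, this, smul_smul, inv_mul_cancel₀ hx, one_smul]
  have h2 : 1 - q • dartWeight G u = (1 + x • J) * (1 - (q • (R * T)) * S) := by
    rw [mul_sub, mul_one, ← Matrix.mul_assoc, Matrix.mul_smul, ← Matrix.mul_assoc, h1,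
      Matrix.one_mul, dartWeight_eq, smul_sub, smul_smul, Matrix.smul_mul]
    abel
  have h3 : S * (q • (R * T)) = (q * (1 - x ^ 2)⁻¹) • (G.adjMatrix ℂ - x • G.degMatrix ℂ) := by
    rw [← fstMatrix_mul_sndMatrix, ← fstMatrix_mul_invMatrix_mul_sndMatrix, hR, Matrix.smul_mul,
      smul_smul, Matrix.mul_smul, Matrix.sub_mul, Matrix.one_mul, Matrix.mul_sub, Matrix.smul_mul,
      Matrix.mul_smul]
  -- Sylvester's identity `det (1 - A B) = det (1 - B A)` passes from darts to vertices.
  rw [h2, Matrix.det_mul, det_one_add_smul_invMatrix o, Matrix.det_one_sub_mul_comm, h3, mul_assoc,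
    mul_comm (Matrix.det _), nV, ← Matrix.det_smul]
  congr 2
  rw [smul_sub, smul_smul, smul_sub, smul_smul]
  have e1 : w * (1 - x ^ 2) * (q * (1 - x ^ 2)⁻¹) = x := by
    rw [mul_mul_mul_comm, mul_inv_cancel₀ hx, mul_one, mul_comm]
  rw [e1, ← pow_two]
  abel

end DeterminantFormula

open Matrix

/-! ### Order of a determinant near a matrix with constant kernel -/

section BorderedDeterminant

variable {n : Type*} [Fintype n] [DecidableEq n]

theorem updateCol_mulVec_eq {R : Type*} [CommRing R] (K : Matrix n n R) (i : n) (y z : n → R) :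
    K.updateCol i y *ᵥ z = K *ᵥ Function.update z i 0 + z i • y := by
  ext k
  have h : z i * y k = ∑ j, if j = i then z i * y k else 0 := by simp
  rw [Pi.add_apply, Pi.smul_apply, smul_eq_mul, h, Matrix.mulVec, Matrix.mulVec, dotProduct,
    dotProduct, ← Finset.sum_add_distrib]
  refine Finset.sum_congr rfl fun j _ => ?_
  by_cases hj : j = i
  · subst hj
    simp [mul_comm]
  · simp [hj]

/-- If the kernel of `K` consists of the constant vectors and the columns of `K` have sum zero, then
replacing a column by `y` gives a regular matrix exactly if the sum of `y` is not zero. -/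
theorem det_updateCol_ne_zero_iff {F : Type*} [Field F] {K : Matrix n n F}
    (hker : ∀ z, K *ᵥ z = 0 → ∀ i j, z i = z j) (hcol : 1 ᵥ* K = 0) (i : n) (y : n → F) :
    (K.updateCol i y).det ≠ 0 ↔ ∑ j, y j ≠ 0 := by
  -- The columns of `K` sum to zero, so only the new column contributes. If `∑ y ≠ 0`, a kernel
  -- vector has `z i = 0`, lies in the kernel of `K` and vanishes. If `∑ y = 0`, the row vector 1 is
  -- in the left kernel.
  have hsum (z : n → F) : 1 ⬝ᵥ (K.updateCol i y *ᵥ z) = z i * ∑ j, y j := by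
    rw [updateCol_mulVec_eq, dotProduct_add, dotProduct_mulVec, hcol, zero_dotProduct, zero_add,
      dotProduct_smul, smul_eq_mul, one_dotProduct]
  rw [not_iff_not, ← Matrix.exists_mulVec_eq_zero_iff]
  constructor
  · rintro ⟨z, hz0, hz⟩
    by_contra hy
    have h1 := hsum z
    rw [hz, dotProduct_zero] at h1
    have hzi : z i = 0 := (mul_eq_zero.1 h1.symm).resolve_right hy
    rw [updateCol_mulVec_eq, hzi, zero_smul, add_zero] at hz
    apply hz0
    ext j
    have h2 := hker _ hz j i
    rw [Function.update_self] at h2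
    by_cases hj : j = i
    · rw [hj, hzi]; rfl
    · rwa [Function.update_of_ne hj] at h2
  · intro hy
    rw [Matrix.exists_mulVec_eq_zero_iff, ← Matrix.exists_vecMul_eq_zero_iff]
    refine ⟨1, ?_, ?_⟩
    · intro h
      exact one_ne_zero (congrFun h i)
    · ext j
      have h := hsum (Pi.single j 1)
      rw [hy, mul_zero, dotProduct_mulVec, dotProduct_single_one] at h
      exact h

open Polynomial in
/-- If `M v = X ^ k y` with `v i` not vanishing at `0`, then `det M` is divisible by `X ^ k`, and the
quotient vanishes at `0` exactly if the sum of `y` does. -/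
theorem exists_det_eq_X_pow_mul {F : Type*} [Field F] {M : Matrix n n F[X]} {v y : n → F[X]}
    {k : ℕ} {i : n} (hker : ∀ z : n → F, M.map (eval (0 : F)) *ᵥ z = 0 → ∀ i j, z i = z j)
    (hcol : (1 : n → F) ᵥ* M.map (eval (0 : F)) = 0) (hv : (v i).eval 0 ≠ 0)
    (h : M *ᵥ v = (X : F[X]) ^ k • y) :
    ∃ g : F[X], M.det = X ^ k * g ∧ (g.eval 0 ≠ 0 ↔ ∑ j, (y j).eval 0 ≠ 0) := by
  -- Cramer's rule for the system `M v = X ^ k y`.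
  have h1 : v i * M.det = X ^ k * (M.updateCol i y).det := by
    have h2 : M.cramer (M *ᵥ v) i = M.det * v i := by
      rw [cramer_eq_adjugate_mulVec, mulVec_mulVec, adjugate_mul, smul_mulVec, one_mulVec]
      rfl
    rw [mul_comm, ← h2, h, map_smul, Pi.smul_apply, smul_eq_mul, cramer_apply]
  have hX : ¬ (X : F[X]) ∣ v i := by
    rwa [X_dvd_iff, coeff_zero_eq_eval_zero]
  obtain ⟨g, hg⟩ : (X : F[X]) ^ k ∣ M.det :=
    prime_X.pow_dvd_of_dvd_mul_left k hX ⟨_, h1⟩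
  refine ⟨g, hg, ?_⟩
  have h3 : v i * g = (M.updateCol i y).det := by
    apply mul_left_cancel₀ (pow_ne_zero k (X_ne_zero (R := F)))
    rw [← h1, hg]
    ring
  have h4 : (M.updateCol i y).det.eval 0 =
      ((M.map (eval 0)).updateCol i fun j => (y j).eval 0).det := by
    rw [← coe_evalRingHom, RingHom.map_det]
    congr 1
    ext a b
    by_cases hb : b = i
    · subst hb; simp
    · simp [hb]
  rw [← det_updateCol_ne_zero_iff hker hcol i, ← h4, ← h3, eval_mul]
  simp [hv]

end BorderedDeterminant

/-! ### The Laplacian, the incidence matrix and its Moore–Penrose inverse -/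

section Laplacian

theorem sum_degree {V : Type*} [Fintype V] (G : SimpleGraph V) [DecidableRel G.Adj]
    (R : Type*) [CommRing R] :
    ∑ v, (G.degree v : R) = 2 * nE G := by
  rw [nE, ← Nat.cast_sum, G.sum_degrees_eq_twice_card_edges]
  push_cast
  rfl

variable {V : Type*} [Fintype V] [DecidableEq V] {G : SimpleGraph V}

theorem incidence_apply (o : EdgeOrientation G) (e : G.edgeSet) (v : V) :
    incidence o e v =
      (if v = (o.dart e).snd then 1 else 0) - (if v = (o.dart e).fst then 1 else 0) := by
  have hne : (o.dart e).fst ≠ (o.dart e).snd := (o.dart e).adj.ne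
  change (if v = (o.dart e).snd then (1 : ℝ) else if v = (o.dart e).fst then -1 else 0) = _
  by_cases h1 : v = (o.dart e).snd
  · subst h1
    simp [hne.symm]
  · by_cases h2 : v = (o.dart e).fst <;> simp [h1, h2, hne]

theorem incidence_mulVec (o : EdgeOrientation G) (z : V → ℝ) (e : G.edgeSet) :
    (incidence o *ᵥ z) e = z (o.dart e).snd - z (o.dart e).fst := by
  simp [Matrix.mulVec, dotProduct, incidence_apply, sub_mul, Finset.sum_sub_distrib]

theorem incidence_mulVec_one (o : EdgeOrientation G) : incidence o *ᵥ 1 = 0 := by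
  ext e
  simp [incidence_mulVec]

variable [DecidableRel G.Adj]

theorem incidence_transpose_mul_self (o : EdgeOrientation G) :
    (incidence o)ᵀ * incidence o = G.lapMatrix ℝ := by
  ext v w
  rw [SimpleGraph.lapMatrix, Matrix.sub_apply, ← sum_darts_fst_fst, ← sum_darts_fst_snd,
    o.sum_darts, o.sum_darts, ← Finset.sum_sub_distrib, Matrix.mul_apply]
  refine Finset.sum_congr rfl fun e _ => ?_
  rw [Matrix.transpose_apply, incidence_apply, incidence_apply]
  simp only [SimpleGraph.Dart.symm_toProd, Prod.fst_swap, Prod.snd_swap]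
  by_cases h1 : v = (o.dart e).snd <;> by_cases h2 : v = (o.dart e).fst <;>
    by_cases h3 : w = (o.dart e).snd <;> by_cases h4 : w = (o.dart e).fst <;>
    simp [h1, h2, h3, h4]

/-- The Laplacian has integer entries, so the real and imaginary parts of `z` lie in the real
kernel. -/
theorem lapMatrix_mulVec_eq_zero (hG : G.Connected) {z : V → ℂ} (hz : G.lapMatrix ℂ *ᵥ z = 0)
    (i j : V) : z i = z j := by
  have key (f : ℂ →+ ℝ) (hf : ∀ (n : ℕ) (x : ℂ), f (n * x) = n * f x) : f (z i) = f (z j) := by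
    have h : G.lapMatrix ℝ *ᵥ (fun v => f (z v)) = 0 := by
      ext v
      have h2 := congrArg f (congrFun hz v)
      rw [SimpleGraph.lapMatrix_mulVec_apply, map_sub, map_sum, hf] at h2
      rw [SimpleGraph.lapMatrix_mulVec_apply, h2, Pi.zero_apply, map_zero, Pi.zero_apply]
    exact (SimpleGraph.lapMatrix_mulVec_eq_zero_iff_forall_reachable G).1 h i j (hG.preconnected i j)
  exact Complex.ext (key Complex.reAddGroupHom (by simp)) (key Complex.imAddGroupHom (by simp))

/-- The vector `-L⁺ (L⁺)ᵀ d`. -/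
noncomputable def potential (o : EdgeOrientation G) : V → ℝ :=
  -(moorePenroseInverse (incidence o) *ᵥ ((moorePenroseInverse (incidence o))ᵀ *ᵥ degreeVector G))

theorem dotProduct_degreeVector_potential (o : EdgeOrientation G) :
    degreeVector G ⬝ᵥ potential o = -‖pinvDegree o‖ ^ 2 := by
  rw [potential, dotProduct_neg, dotProduct_mulVec, ← mulVec_transpose, EuclideanSpace.norm_sq_eq,
    neg_inj, dotProduct]
  refine Finset.sum_congr rfl fun e _ => ?_
  rw [Real.norm_eq_abs, sq_abs, pow_two]
  rfl

/-- The range of `L⁺` is the row space of `L`, which is orthogonal to the constants. -/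
theorem sum_potential (o : EdgeOrientation G) : ∑ v, potential o v = 0 := by
  have h := isMoorePenroseInverse_moorePenroseInverse (incidence o)
  have h1 : (moorePenroseInverse (incidence o))ᵀ *ᵥ (1 : V → ℝ) = 0 := by
    conv_lhs => rw [← h.self_mul_mul]
    rw [transpose_mul, h.left_symm, ← mulVec_mulVec, ← mulVec_mulVec, incidence_mulVec_one,
      mulVec_zero, mulVec_zero]
  rw [← one_dotProduct, potential, dotProduct_neg, dotProduct_mulVec, ← mulVec_transpose, h1,
    zero_dotProduct, neg_zero]

/-- `LᵀL L⁺(L⁺)ᵀ = L⁺L` is the orthogonal projection onto the complement of the constants. Hence `d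
- L⁺L d` is constant, equal to the mean degree `2 n_E / n_V = 2 w`. -/
theorem lapMatrix_mulVec_potential (hG : G.Connected) (o : EdgeOrientation G) {w : ℝ}
    (hw : nV V * w = nE G) (v : V) :
    (G.lapMatrix ℝ *ᵥ potential o) v = 2 * w - G.degree v := by
  have h := isMoorePenroseInverse_moorePenroseInverse (incidence o)
  set L := incidence o with hL
  set N := moorePenroseInverse L
  set d := degreeVector G with hd
  have h1 : Lᵀ * L * (N * Nᵀ) = N * L := by
    rw [Matrix.mul_assoc, ← Matrix.mul_assoc L, ← h.right_symm, transpose_mul, ← Matrix.mul_assoc,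
      ← Matrix.mul_assoc, ← transpose_mul, Matrix.mul_assoc, ← transpose_mul, ← transpose_mul,
      ← Matrix.mul_assoc, h.self_mul_mul, h.left_symm]
  have h2 : L *ᵥ (d - (N * L) *ᵥ d) = 0 := by
    rw [mulVec_sub, mulVec_mulVec, ← Matrix.mul_assoc, h.mul_mul_self, sub_self]
  have h3 : G.lapMatrix ℝ *ᵥ (d - (N * L) *ᵥ d) = 0 := by
    rw [← incidence_transpose_mul_self o, ← mulVec_mulVec, h2, mulVec_zero]
  have h4 (i : V) : (d - (N * L) *ᵥ d) i = (d - (N * L) *ᵥ d) v :=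
    (SimpleGraph.lapMatrix_mulVec_eq_zero_iff_forall_reachable G).1 h3 i v (hG.preconnected i v)
  have h5 : ∑ i, ((N * L) *ᵥ d) i = 0 := by
    rw [← one_dotProduct, dotProduct_mulVec, ← mulVec_transpose, h.left_symm, ← mulVec_mulVec,
      incidence_mulVec_one, mulVec_zero, zero_dotProduct]
  have h6 : ∑ i, (d - (N * L) *ᵥ d) i = 2 * nE G := by
    simp only [Pi.sub_apply]
    rw [Finset.sum_sub_distrib, h5, sub_zero, ← sum_degree]
    rfl
  rw [Finset.sum_congr rfl fun i _ => h4 i, Finset.sum_const, Finset.card_univ, nsmul_eq_mul,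
    ← hw] at h6
  have := hG.nonempty
  have hn : (nV V : ℝ) ≠ 0 := Nat.cast_ne_zero.2 Fintype.card_ne_zero
  have h7 : (d - (N * L) *ᵥ d) v = 2 * w := by
    apply mul_left_cancel₀ hn
    rw [mul_left_comm, ← h6]
    rfl
  have h8 : potential o = -(N *ᵥ (Nᵀ *ᵥ d)) := rfl
  rw [h8, ← incidence_transpose_mul_self o, ← hL, mulVec_neg, mulVec_mulVec, mulVec_mulVec,
    Matrix.mul_assoc (Lᵀ * L), h1, ← h7]
  simp [hd, degreeVector]

end Laplacian

/-! ### Order of vanishing of the pencil -/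

section ZeroOrder

open Polynomial

variable {V : Type*} [Fintype V] [DecidableEq V]

/-- The matrix `w (1 - x²) - x A + x² D` of the determinant formula with `x = 1 + X`. -/
noncomputable def pencil (G : SimpleGraph V) [DecidableRel G.Adj] (w : ℂ) : Matrix V V ℂ[X] :=
  (C w * (1 - (1 + X) ^ 2)) • (1 : Matrix V V ℂ[X]) - (1 + X : ℂ[X]) • G.adjMatrix ℂ[X] +
    ((1 + X : ℂ[X]) ^ 2) • G.degMatrix ℂ[X]

variable {G : SimpleGraph V} [DecidableRel G.Adj]

theorem map_eval_pencil (w s : ℂ) : (pencil G w).map (eval s) =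
    (w * (1 - (1 + s) ^ 2)) • (1 : Matrix V V ℂ) - (1 + s) • G.adjMatrix ℂ +
      (1 + s) ^ 2 • G.degMatrix ℂ := by
  ext i j
  simp only [pencil, map_apply, Matrix.add_apply, Matrix.sub_apply, Matrix.smul_apply, smul_eq_mul,
    Matrix.one_apply, SimpleGraph.adjMatrix_apply, SimpleGraph.degMatrix, diagonal_apply]
  split_ifs <;> simp

theorem eval_det_pencil (w s : ℂ) : (pencil G w).det.eval s =
    ((w * (1 - (1 + s) ^ 2)) • (1 : Matrix V V ℂ) - (1 + s) • G.adjMatrix ℂ +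
      (1 + s) ^ 2 • G.degMatrix ℂ).det := by
  rw [← map_eval_pencil, ← coe_evalRingHom, RingHom.map_det]
  rfl

theorem map_eval_zero_pencil (w : ℂ) : (pencil G w).map (eval 0) = G.lapMatrix ℂ := by
  rw [map_eval_pencil, SimpleGraph.lapMatrix]
  simp only [add_zero, one_pow, sub_self, mul_zero, zero_smul, one_smul, zero_sub]
  abel

theorem pencil_mulVec (w : ℂ) (v : V → ℂ[X]) (i : V) : (pencil G w *ᵥ v) i =
    C w * (1 - (1 + X) ^ 2) * v i - (1 + X) * (∑ j ∈ G.neighborFinset i, v j) +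
      (1 + X) ^ 2 * ((G.degree i : ℂ[X]) * v i) := by
  rw [pencil, add_mulVec, sub_mulVec, smul_mulVec, smul_mulVec, smul_mulVec, one_mulVec]
  simp [SimpleGraph.degMatrix_mulVec_apply]

theorem one_vecMul_lapMatrix : (1 : V → ℂ) ᵥ* G.lapMatrix ℂ = 0 := by
  rw [← mulVec_transpose, (G.isSymm_lapMatrix ℂ).eq]
  exact G.lapMatrix_mulVec_const_eq_zero

/-- The kernel vector `v = 1` of the Laplacian gives `M v = X y` with `y(0) = d - 2 w`, whose sum is
`2 (n_E - n_V w)`. -/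
theorem det_pencil_first_order (hG : G.Connected) (w : ℂ) :
    ∃ g : ℂ[X], (pencil G w).det = X ^ 1 * g ∧ (g.eval 0 ≠ 0 ↔ nV V * w ≠ nE G) := by
  obtain ⟨i⟩ := hG.nonempty
  obtain ⟨g, hg, hg0⟩ := exists_det_eq_X_pow_mul (M := pencil G w) (v := 1) (k := 1) (i := i)
    (y := fun i => (1 + X) * (G.degree i : ℂ[X]) - C w * (2 + X))
    (by rw [map_eval_zero_pencil]; exact fun z hz => lapMatrix_mulVec_eq_zero hG hz)
    (by rw [map_eval_zero_pencil]; exact one_vecMul_lapMatrix) (by simp) (by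
      ext1 i
      rw [pencil_mulVec]
      simp only [Pi.one_apply, Finset.sum_const, SimpleGraph.card_neighborFinset_eq_degree,
        nsmul_eq_mul, Pi.smul_apply, smul_eq_mul]
      ring)
  refine ⟨g, hg, hg0.trans ?_⟩
  have : ∑ j : V, eval 0 ((1 + X) * (G.degree j : ℂ[X]) - C w * (2 + X)) =
      2 * (nE G - nV V * w) := by
    simp only [eval_sub, eval_mul, eval_add, eval_one, eval_X, eval_natCast, eval_C, eval_ofNat,
      add_zero, one_mul]
    rw [Finset.sum_sub_distrib, sum_degree, Finset.sum_const, Finset.card_univ, nsmul_eq_mul, nV]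
    ring
  rw [this, ne_eq, ne_eq, not_iff_not, mul_eq_zero, sub_eq_zero, eq_comm (a := (nE G : ℂ))]
  simp

/-- The correction `c = potential o` solves `(D - A) c = 2 w - d`, which cancels the term of order
`X` in `M (1 + X c)`. The next coefficient is `w - 2 w c_i + d_i c_i`. As `∑ c = 0` and `d ⬝ c =
-|(L⁺)ᵀ d|²`, it sums to `n_E - |(L⁺)ᵀ d|²`. -/
theorem det_pencil_second_order (hG : G.Connected) (o : EdgeOrientation G) {w : ℂ}
    (hw : nV V * w = nE G) :
    ∃ g : ℂ[X], (pencil G w).det = X ^ 2 * g ∧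
      (g.eval 0 ≠ 0 ↔ ‖pinvDegree o‖ ^ 2 ≠ (nE G : ℝ)) := by
  obtain ⟨i⟩ := hG.nonempty
  have := hG.nonempty
  have hn : (nV V : ℝ) ≠ 0 := Nat.cast_ne_zero.2 Fintype.card_ne_zero
  -- The critical `w` is the real number `n_E / n_V`, so the real potential applies.
  obtain ⟨r, rfl, hr⟩ : ∃ r : ℝ, (r : ℂ) = w ∧ nV V * r = nE G := by
    refine ⟨nE G / nV V, ?_, mul_div_cancel₀ _ hn⟩
    have hn' : (nV V : ℂ) ≠ 0 := by exact_mod_cast hn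
    apply mul_left_cancel₀ hn'
    rw [hw]
    push_cast
    exact mul_div_cancel₀ _ hn'
  have hc (i : V) : ∑ j ∈ G.neighborFinset i, (potential o j : ℂ) =
      G.degree i * potential o i - (2 * r - G.degree i) := by
    have h := lapMatrix_mulVec_potential hG o hr i
    rw [SimpleGraph.lapMatrix_mulVec_apply] at h
    rw [← Complex.ofReal_sum]
    rw [sub_eq_iff_eq_add] at h
    apply Eq.symm
    rw [sub_eq_iff_eq_add]
    exact_mod_cast h.trans (add_comm _ _)
  set c : V → ℂ := fun v => potential o v
  obtain ⟨g, hg, hg0⟩ := exists_det_eq_X_pow_mul (M := pencil G r)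
    (v := fun v => 1 + X * C (c v)) (k := 2) (i := i)
    (y := fun i => C (r : ℂ) - C (r : ℂ) * (2 + X) * C (c i) +
      (1 + X) * ((G.degree i : ℂ[X]) * C (c i)))
    (by rw [map_eval_zero_pencil]; exact fun z hz => lapMatrix_mulVec_eq_zero hG hz)
    (by rw [map_eval_zero_pencil]; exact one_vecMul_lapMatrix) (by simp) (by
      ext1 i
      rw [pencil_mulVec, Finset.sum_add_distrib, ← Finset.mul_sum, ← map_sum, hc]
      simp only [Finset.sum_const, SimpleGraph.card_neighborFinset_eq_degree, C_sub, C_mul,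
        C_ofNat, map_natCast, nsmul_eq_mul, Pi.smul_apply, smul_eq_mul, mul_one]
      ring)
  refine ⟨g, hg, hg0.trans ?_⟩
  have h1 : ∑ v, c v = 0 := by
    rw [← Complex.ofReal_sum, sum_potential, Complex.ofReal_zero]
  have h2 : ∑ v, (G.degree v : ℂ) * c v = ((-‖pinvDegree o‖ ^ 2 : ℝ) : ℂ) := by
    rw [← dotProduct_degreeVector_potential, dotProduct, Complex.ofReal_sum]
    refine Finset.sum_congr rfl fun v _ => ?_
    rw [Complex.ofReal_mul]
    simp [degreeVector, c]
  have : ∑ j : V, eval 0 (C (r : ℂ) - C (r : ℂ) * (2 + X) * C (c j) +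
      (1 + X) * ((G.degree j : ℂ[X]) * C (c j))) = ((nE G - ‖pinvDegree o‖ ^ 2 : ℝ) : ℂ) := by
    simp only [eval_sub, eval_mul, eval_add, eval_one, eval_X, eval_natCast, eval_C, eval_ofNat,
      add_zero, one_mul]
    rw [Finset.sum_add_distrib, Finset.sum_sub_distrib, ← Finset.mul_sum, h1, h2, Finset.sum_const,
      Finset.card_univ, nsmul_eq_mul]
    push_cast
    rw [← hw, nV]
    ring
  rw [this, ne_eq, ne_eq, not_iff_not, Complex.ofReal_eq_zero, sub_eq_zero, eq_comm]

theorem le_of_X_pow_mul_eq {F : Type*} [Field F] {a b : ℕ} {g h : F[X]} (hg : g.eval 0 ≠ 0)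
    (e : X ^ a * g = X ^ b * h) : b ≤ a := by
  have hX : ¬ (X : F[X]) ∣ g := by rwa [X_dvd_iff, coeff_zero_eq_eval_zero]
  have h1 : (X : F[X]) ^ b ∣ X ^ a := prime_X.pow_dvd_of_dvd_mul_right b hX ⟨h, e⟩
  exact (pow_dvd_pow_iff X_ne_zero not_isUnit_X).1 h1

theorem det_pencil_ne_zero {w : ℂ} (hw : w ≠ 0) : (pencil G w).det ≠ 0 := by
  intro h
  -- `X = -1` means `x = 0`, where the pencil is the scalar matrix `w`.
  have h1 := eval_det_pencil (G := G) w (-1)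
  rw [h, eval_zero] at h1
  simp only [add_neg_cancel, ne_eq, OfNat.ofNat_ne_zero, not_false_eq_true, zero_pow, sub_zero,
    mul_one, zero_smul, add_zero, det_smul, det_one] at h1
  exact pow_ne_zero _ hw h1.symm

/-- The order of vanishing of the determinant of the pencil at `0`. -/
theorem exists_order_det_pencil (hG : G.Connected) (o : EdgeOrientation G) {w : ℂ} (hw : w ≠ 0) :
    ∃ (k : ℕ) (g : ℂ[X]), (pencil G w).det = X ^ k * g ∧ g.eval 0 ≠ 0 ∧ 1 ≤ k ∧
      (2 ≤ k ↔ nV V * w = nE G) ∧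
      (nV V * w = nE G → ‖pinvDegree o‖ ^ 2 ≠ (nE G : ℝ) → k = 2) := by
  obtain ⟨g, hg, hX⟩ := exists_eq_pow_rootMultiplicity_mul_and_not_dvd _
    (det_pencil_ne_zero (G := G) hw) 0
  rw [C_0, sub_zero] at hg hX
  set k := rootMultiplicity 0 (pencil G w).det
  have hg0 : g.eval 0 ≠ 0 := by rwa [X_dvd_iff, coeff_zero_eq_eval_zero] at hX
  obtain ⟨g₁, h₁, h₁'⟩ := det_pencil_first_order hG w
  refine ⟨k, g, hg, hg0, le_of_X_pow_mul_eq hg0 (hg.symm.trans h₁), ⟨fun hk => ?_, fun h => ?_⟩,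
    fun h hne => ?_⟩
  · by_contra hne
    have := le_of_X_pow_mul_eq (h₁'.2 hne) (h₁.symm.trans hg)
    omega
  · obtain ⟨g₂, h₂, -⟩ := det_pencil_second_order hG o h
    exact le_of_X_pow_mul_eq hg0 (hg.symm.trans h₂)
  · obtain ⟨g₂, h₂, h₂'⟩ := det_pencil_second_order hG o h
    exact le_antisymm (le_of_X_pow_mul_eq (h₂'.2 hne) (h₂.symm.trans hg))
      (le_of_X_pow_mul_eq hg0 (hg.symm.trans h₂))

end ZeroOrder

theorem nV_mul_eq_iff_eq_uStar {V : Type*} [Fintype V] [Nonempty V] (G : SimpleGraph V)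
    [DecidableRel G.Adj] (u : ℂ) :
    (nV V : ℂ) * (1 - u) = nE G ↔ u = uStar G := by
  have hn : (nV V : ℂ) ≠ 0 := Nat.cast_ne_zero.2 Fintype.card_ne_zero
  rw [uStar, mul_comm, ← eq_div_iff hn]
  constructor <;> intro h <;> linear_combination -h

/-! ### Order of the zeta function at the critical point -/

section PoleOrder

open Polynomial

variable {V : Type*} [Fintype V] [DecidableEq V] {G : SimpleGraph V} [DecidableRel G.Adj]

theorem meromorphicOrderAt_det_inv (o : EdgeOrientation G) {u : ℂ} (hu : u ≠ 1) {k : ℕ}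
    {g : ℂ[X]} (hg : (pencil G (1 - u)).det = X ^ k * g) (hg0 : g.eval 0 ≠ 0) :
    meromorphicOrderAt (fun q => (1 - q • dartWeight G u).det⁻¹) (1 - u)⁻¹ =
      (((nV V : ℤ) - nE G - k : ℤ) : WithTop ℤ) := by
  have hw : 1 - u ≠ 0 := sub_ne_zero.2 hu.symm
  obtain ⟨w, hwdef⟩ : ∃ w, w = 1 - u := ⟨_, rfl⟩
  rw [← hwdef] at hw hg ⊢
  have hs0 : w⁻¹ * w - 1 = 0 := by rw [inv_mul_cancel₀ hw, sub_self]
  have hga : Differentiable ℂ fun q : ℂ => g.eval (q * w - 1) :=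
    g.differentiable.comp (by fun_prop)
  rw [meromorphicOrderAt_eq_int_iff (meromorphic_det_inv _ _)]
  -- With `s = q w - 1 = w (q - w⁻¹)` one has `1 - x² = s (-(2 + s))`. The determinant formula then
  -- leaves `s ^ (n_V - n_E - k)` times factors regular and nonzero at `s = 0`.
  refine ⟨fun q => w ^ nV V * (-(2 + (q * w - 1))) ^ ((nV V : ℤ) - nE G) *
    w ^ ((nV V : ℤ) - nE G - k) * (g.eval (q * w - 1))⁻¹, ?_, ?_, ?_⟩
  · refine AnalyticAt.mul (AnalyticAt.mul (AnalyticAt.mul analyticAt_const ?_) analyticAt_const) ?_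
    · refine AnalyticAt.zpow ?_ ?_
      · exact Differentiable.analyticAt (by fun_prop) _
      · rw [hs0]; simp
    · refine (hga.analyticAt _).inv ?_
      rwa [hs0]
  · beta_reduce
    rw [hs0]
    have h2 : (-(2 + 0) : ℂ) ≠ 0 := by simp
    exact mul_ne_zero (mul_ne_zero (mul_ne_zero (pow_ne_zero _ hw) (zpow_ne_zero _ h2))
      (zpow_ne_zero _ hw)) (inv_ne_zero hg0)
  · have h1 : ∀ᶠ q in nhdsWithin w⁻¹ {w⁻¹}ᶜ, g.eval (q * w - 1) ≠ 0 := by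
      refine Filter.Eventually.filter_mono nhdsWithin_le_nhds ?_
      exact hga.continuous.continuousAt.eventually_ne (by rwa [hs0])
    have h2 : ∀ᶠ q in nhdsWithin w⁻¹ {w⁻¹}ᶜ, -(2 + (q * w - 1)) ≠ 0 := by
      refine Filter.Eventually.filter_mono nhdsWithin_le_nhds ?_
      have hc : Continuous fun q : ℂ => -(2 + (q * w - 1)) := by fun_prop
      exact hc.continuousAt.eventually_ne (by rw [hs0]; simp)
    filter_upwards [h1, h2, self_mem_nhdsWithin] with q hgq h2q hq
    have hq' : q - w⁻¹ ≠ 0 := sub_ne_zero.2 hq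
    have es : q * w - 1 = w * (q - w⁻¹) := by
      rw [mul_sub, mul_inv_cancel₀ hw, mul_comm w]
    have hs : q * w - 1 ≠ 0 := by rw [es]; exact mul_ne_zero hw hq'
    have e1 : 1 - (q * w) ^ 2 = (q * w - 1) * -(2 + (q * w - 1)) := by ring
    have hx : 1 - (q * w) ^ 2 ≠ 0 := by rw [e1]; exact mul_ne_zero hs h2q
    have hdet := det_one_sub_smul_dartWeight o u q (hwdef ▸ hx)
    have hp := eval_det_pencil (G := G) w (q * w - 1)
    rw [hg, eval_mul, eval_pow, eval_X, add_sub_cancel] at hp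
    rw [← hwdef, ← hp, e1, mul_pow w] at hdet
    generalize (1 - q • dartWeight G u).det = P at hdet ⊢
    have e3 : w ^ ((nV V : ℤ) - nE G - k) * (q - w⁻¹) ^ ((nV V : ℤ) - nE G - k) =
        (q * w - 1) ^ ((nV V : ℤ) - nE G - k) := by rw [← mul_zpow, ← es]
    generalize q * w - 1 = s at *
    generalize g.eval s = y at *
    generalize -(2 + s) = t at *
    have e4 : s ^ ((nV V : ℤ) - nE G - k) = s ^ nV V / s ^ nE G / s ^ k := by
      rw [zpow_sub₀ hs, zpow_sub₀ hs, zpow_natCast, zpow_natCast, zpow_natCast]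
    have e5 : t ^ ((nV V : ℤ) - nE G) = t ^ nV V / t ^ nE G := by
      rw [zpow_sub₀ h2q, zpow_natCast, zpow_natCast]
    have hP : P ≠ 0 := by
      rintro rfl
      rw [zero_mul] at hdet
      exact mul_ne_zero (pow_ne_zero _ (mul_ne_zero hs h2q)) (mul_ne_zero (pow_ne_zero _ hs) hgq)
        hdet.symm
    rw [smul_eq_mul]
    calc P⁻¹ = w ^ nV V * t ^ ((nV V : ℤ) - nE G) * s ^ ((nV V : ℤ) - nE G - k) * y⁻¹ := by
          rw [e4, e5]
          field_simp
          rw [mul_pow, mul_pow] at hdet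
          linear_combination -hdet
      _ = _ := by rw [← e3]; ring

/-- The order of the Bartholdi zeta function at `(1 - u)⁻¹`. -/
theorem exists_meromorphicOrderAt_zeta (hG : G.Connected) (o : EdgeOrientation G) {u : ℂ}
    (hu : u ≠ 1) :
    ∃ k : ℕ, 1 ≤ k ∧ (2 ≤ k ↔ u = uStar G) ∧
      (u = uStar G → ‖pinvDegree o‖ ^ 2 ≠ (nE G : ℝ) → k = 2) ∧
      ∀ ζ : ℂ → ℂ, IsBartholdiZeta G u ζ → meromorphicOrderAt ζ (1 - u)⁻¹ =
        ((-((nE G : ℤ) - nV V + k) : ℤ) : WithTop ℤ) := by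
  have := hG.nonempty
  obtain ⟨k, g, hg, hg0, hk, hk2, hk3⟩ :=
    exists_order_det_pencil hG o (sub_ne_zero.2 hu.symm : 1 - u ≠ 0)
  rw [nV_mul_eq_iff_eq_uStar] at hk2 hk3
  refine ⟨k, hk, hk2, hk3, fun ζ hζ => ?_⟩
  rw [meromorphicOrderAt_congr (hζ.eventuallyEq (isBartholdiZeta_det_inv u) _),
    meromorphicOrderAt_det_inv o hu hg hg0]
  congr 1
  ring

end PoleOrder

end Bartholdi

/-! ### The main theorem -/

theorem theorem4p16 {V : Type*} [Fintype V] [DecidableEq V] (G : SimpleGraph V)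
    [DecidableRel G.Adj] (o : Bartholdi.EdgeOrientation G) (hG : G.Connected)
    (u : ℂ) (hu : u ≠ 1) :
    (∃ ζ : ℂ → ℂ, Bartholdi.IsBartholdiZeta G u ζ) ∧
    ∀ ζ : ℂ → ℂ, Bartholdi.IsBartholdiZeta G u ζ →
      (¬ G.IsTree →
        (u ≠ Bartholdi.uStar G →
          Bartholdi.HasPoleOfOrder ζ (1 - u)⁻¹
            ((Bartholdi.nE G : ℤ) - (Bartholdi.nV V : ℤ) + 1)) ∧
        ((∃ k : ℤ, (Bartholdi.nE G : ℤ) - (Bartholdi.nV V : ℤ) + 2 ≤ k ∧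
          Bartholdi.HasPoleOfOrder ζ (1 - u)⁻¹ k) ↔ u = Bartholdi.uStar G)) ∧
      (G.IsTree → (Bartholdi.IsPole ζ (1 - u)⁻¹ ↔ u = Bartholdi.uStar G)) ∧
      (‖Bartholdi.pinvDegree o‖ ^ 2 ≠ (Bartholdi.nE G : ℝ) → u = Bartholdi.uStar G →
        Bartholdi.HasPoleOfOrder ζ (1 - u)⁻¹
          ((Bartholdi.nE G : ℤ) - (Bartholdi.nV V : ℤ) + 2)) := by
  refine ⟨⟨_, Bartholdi.isBartholdiZeta_det_inv u⟩, fun ζ hζ => ?_⟩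
  obtain ⟨k, hk, hk2, hk3, hord⟩ := Bartholdi.exists_meromorphicOrderAt_zeta hG o hu
  have hord := hord ζ hζ
  have hmer := hζ.1 (1 - u)⁻¹
  have hE : Nat.card G.edgeSet = Bartholdi.nE G := by
    rw [Nat.card_eq_fintype_card, Bartholdi.nE, SimpleGraph.edgeFinset_card]
  have hV : Nat.card V = Bartholdi.nV V := Nat.card_eq_fintype_card
  have hle : Bartholdi.nV V ≤ Bartholdi.nE G + 1 := by
    rw [← hE, ← hV]
    exact hG.card_vert_le_card_edgeSet_add_one
  have htree : G.IsTree ↔ Bartholdi.nE G + 1 = Bartholdi.nV V := by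
    rw [SimpleGraph.isTree_iff_connected_and_card, hE, hV, and_iff_right hG]
  -- The zeta function has order `-(n_E - n_V + k)`. For a tree this is `1 - k`, negative iff `k ≥
  -- 2`; otherwise `n_E ≥ n_V` and `k ≥ 1` already gives a pole.
  refine ⟨fun hT => ⟨fun hne => ?_, ⟨?_, fun heq => ?_⟩⟩, fun hT => ?_, fun hne heq => ?_⟩
  · have h1 : k = 1 := by
      have := mt hk2.1 hne
      omega
    have h2 := mt htree.2 hT
    subst h1
    exact ⟨by omega, hmer, by exact_mod_cast hord⟩
  · rintro ⟨j, hj, -, -, hj'⟩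
    rw [hord] at hj'
    have := WithTop.coe_injective hj'
    exact hk2.1 (by omega)
  · have h1 := hk2.2 heq
    have h2 := mt htree.2 hT
    exact ⟨(Bartholdi.nE G : ℤ) - Bartholdi.nV V + k, by omega, by omega, hmer, hord⟩
  · have h1 := htree.1 hT
    rw [Bartholdi.IsPole, hord, and_iff_right hmer, ← hk2, ← WithTop.coe_zero,
      WithTop.coe_lt_coe]
    omega
  · have h1 := hk3 heq hne
    subst h1
    exact ⟨by omega, hmer, by exact_mod_cast hord⟩
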